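/- **Setting.** Let $G=(V,E)$ be a connected simple graph on $V=\{1,\dots,n\}$, $n\ge 3$, with edge weights $w_e\ge 1$. Let $\vec E$ be the edges directed from the smaller to the larger endpoint, $B\in\{-1,0,1\}^{V\times\vec E}$ the incidence matrix ($B_{s,e}=1$, $B_{t,e}=-1$ for $e=(s,t)$), and $W=\mathrm{diag}(w_e)$. A demand $d\in\mathbb R^V$ is proper if $\sum_v d_v=0$, and $\|d\|_{\mathrm{OPT}}=\min\{\|Wf\|_1: f\in\mathbb R^{\vec E},\ Bf=d\}$. A matrix $R\in\mathbb R^{\vec E\times V}$ is an $a$-approximate (linear) $\ell_1$-oblivious routing if $BRd=d$ and $\|WRd\|_1\le a\,\|d\|_{\mathrm{OPT}}$ for every proper demand $d$. A low-diameter decomposition (LDD) of radius $r$ and quality $a$ with failure probability $\delta$ is a probability distribution over partitions of $V$ into parts $S_1,\dots,S_k$, each inducing a connected subgraph and having a center $c_l\in S_l$, such that (1) with probability at least $1-\delta$, for every $l$ every vertex of $S_l$ is within weighted distance $r$ of $c_l$ in $G[S_l]$; and (2) any two vertices $x,y$ lie in different parts with probability at most $a\cdot \mathrm{dist}_G(x,y)/r$.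 **Algorithm.** Given $\rho>0$, positive integers $m,g$ and distributions $\mathcal D_1,\dots,\mathcal D_m$ over such partitions with centers, sample independently, for $1\le i\le m$ and $1\le j\le g$, a partition $\mathcal P^i_j$ from $\mathcal D_i$. Starting from a demand $d_0=d$, in step $i=1,\dots,m$ each vertex $v$ sends $\frac1g d_{i-1}(v)$ to the center of its part in each $\mathcal P^i_j$, along an arbitrary path of $G$ of weighted length at most $\rho^i$ (chosen independently of $d$); the demand that results at the centers is $d_i$. Finally each $v$ sends $d_m(v)$ to the root along an arbitrary rooted spanning tree of $G$ (also chosen independently of $d$). The output is the matrix $R$ for which $Rd$ is the total flow sent, for every $d\in\mathbb R^V$. **Theorem.** (a) There is a constant $c_0>0$ such that every connected graph on $n\ge3$ vertices with edge weights at least $1$ has, for every $r\ge1$, an LDD of radius $r$ and quality $\exp(c_0\sqrt{\log n\cdot\log\log n})$ with failure probability $0$. (b) Let $C\ge0$ and $c_\alpha,c_\rho,c_i>0$ be constants. For $n\ge 3$ put $$\alpha=\exp\!\big(c_\alpha\sqrt{\log n\cdot\log\log n}\big),\qquad \rho=\exp\!\big((c_\rho\log n\cdot\log\log n)^{3/4}\big),\qquad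 m=\big\lceil (c_i\log n)^{1/4}\big\rceil .$$ There is a constant $A>0$, depending only on $C,c_\alpha,c_\rho,c_i$, such that the following holds for every $C'>0$, every sufficiently large constant $c_g$ (depending on $C'$ and the constants above), and every sufficiently large $K$ (depending on $c_g$, $C'$ and the constants above). Let $g=\lceil c_g\log n\cdot\rho/\alpha\rceil$. For every $n\ge3$ with $\rho^{m}\ge n^{C+1}$, every connected weighted graph $G$ on $n$ vertices with weights in $[1,n^C]$, and all LDDs $\mathcal D_1,\dots,\mathcal D_m$ of $G$, where $\mathcal D_i$ has radius $\rho^i$, quality $\alpha$ and failure probability $n^{-K}$, with probability at least $1-n^{-C'}$ over the samples the algorithm can be carried out (paths as required exist) and, whatever paths, spanning tree and root are chosen, its output $R$ is an $$\exp\!\big((A\log n\cdot\log\log n)^{3/4}\big)\text{-approximate linear } \ell_1\text{-oblivious routing.}$$ -/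

import Mathlib

open MeasureTheory

namespace ObliviousRouting

noncomputable section

/-! ### Graphs on the vertex set `Fin n`, flows and transshipment

A weighted graph is a simple graph `G` on `Fin n` with a weight function `w` on unordered pairs; only
the values of `w` on edges of `G` matter. -/

/-- The edges of `G`, each directed from its smaller to its larger endpoint. -/
abbrev DirEdge {n : ℕ} (G : SimpleGraph (Fin n)) : Type :=
  {e : Fin n × Fin n // G.Adj e.1 e.2 ∧ e.1 < e.2}

instance {n : ℕ} (G : SimpleGraph (Fin n)) : Fintype (DirEdge G) := by
  classical
  infer_instance

/-- The node-edge incidence matrix `B`. -/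
def incidence {n : ℕ} (G : SimpleGraph (Fin n)) : Matrix (Fin n) (DirEdge G) ℝ :=
  Matrix.of fun v e => if v = e.1.1 then 1 else if v = e.1.2 then -1 else 0

/-- The diagonal weight matrix `W`. -/
def weightMatrix {n : ℕ} (G : SimpleGraph (Fin n)) (w : Sym2 (Fin n) → ℝ) :
    Matrix (DirEdge G) (DirEdge G) ℝ :=
  Matrix.diagonal fun e => w s(e.1.1, e.1.2)

/-- The cost `‖W f‖₁` of a flow `f`. -/
def cost {n : ℕ} (G : SimpleGraph (Fin n)) (w : Sym2 (Fin n) → ℝ) (f : DirEdge G → ℝ) : ℝ :=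
  ∑ e, |((weightMatrix G w).mulVec f) e|

/-- A demand is proper if its entries sum to zero. -/
def IsProper {n : ℕ} (d : Fin n → ℝ) : Prop := ∑ v, d v = 0

/-- `f` routes `d` if `B f = d`. -/
def Routes {n : ℕ} (G : SimpleGraph (Fin n)) (f : DirEdge G → ℝ) (d : Fin n → ℝ) : Prop :=
  (incidence G).mulVec f = d

/-- `‖d‖_OPT`, the optimal cost of a flow that routes `d`. -/
def opt {n : ℕ} (G : SimpleGraph (Fin n)) (w : Sym2 (Fin n) → ℝ) (d : Fin n → ℝ) : ℝ :=
  ⨅ f : {f : DirEdge G → ℝ // Routes G f d}, cost G w f.1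

/-- A (linear) oblivious routing: `B R d = d` for every proper demand `d`. -/
def IsObliviousRouting {n : ℕ} (G : SimpleGraph (Fin n))
    (R : Matrix (DirEdge G) (Fin n) ℝ) : Prop :=
  ∀ d : Fin n → ℝ, IsProper d → Routes G (R.mulVec d) d

/-- An `a`-approximate (linear) `ℓ₁`-oblivious routing. -/
def IsApproxObliviousRouting {n : ℕ} (G : SimpleGraph (Fin n)) (w : Sym2 (Fin n) → ℝ) (a : ℝ)
    (R : Matrix (DirEdge G) (Fin n) ℝ) : Prop :=
  IsObliviousRouting G R ∧
    ∀ d : Fin n → ℝ, IsProper d → cost G w (R.mulVec d) ≤ a * opt G w d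

/-! ### Weighted distances and low-diameter decompositions -/

/-- The weighted length of a walk. -/
def walkLength {n : ℕ} {G : SimpleGraph (Fin n)} (w : Sym2 (Fin n) → ℝ) {u v : Fin n}
    (p : G.Walk u v) : ℝ :=
  (p.edges.map w).sum

/-- The weighted distance in `G` (used for connected `G` with positive weights). -/
def wdist {n : ℕ} (G : SimpleGraph (Fin n)) (w : Sym2 (Fin n) → ℝ) (u v : Fin n) : ℝ :=
  ⨅ p : G.Walk u v, walkLength w p

/-- A partition of the vertices into connected parts, each with a center in it. It is recorded by the
map that sends a vertex to the center of its part: the parts are the fibers of `center`, and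
idempotence says that each center lies in its own part. -/
structure Clustering {n : ℕ} (G : SimpleGraph (Fin n)) where
  center : Fin n → Fin n
  center_center : ∀ v, center (center v) = center v
  connected : ∀ v, (G.induce {u | center u = center v}).Connected

/-- All sets of clusterings are events (there are finitely many clusterings). -/
instance {n : ℕ} (G : SimpleGraph (Fin n)) : MeasurableSpace (Clustering G) := ⊤

instance {n : ℕ} (G : SimpleGraph (Fin n)) : Finite (Clustering G) :=
  Finite.of_injective (fun P => P.center) (by
    intro P Q h
    cases P
    cases Q
    simp_all)

/-- Every vertex `v` is within distance `r` of the center of its part `S`, inside the induced graph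
`G[S]`, whose walks are the walks of `G` that stay in `S`. -/
def Clustering.HasRadius {n : ℕ} {G : SimpleGraph (Fin n)} (P : Clustering G)
    (w : Sym2 (Fin n) → ℝ) (r : ℝ) : Prop :=
  ∀ v, ∃ p : G.Walk v (P.center v),
    (∀ u ∈ p.support, P.center u = P.center v) ∧ walkLength w p ≤ r

/-- `D` is a low-diameter decomposition of radius `r` and quality `a`, where the radius property is
allowed to fail with probability at most `δ`. -/
def IsLDD {n : ℕ} (G : SimpleGraph (Fin n)) (w : Sym2 (Fin n) → ℝ) (r a δ : ℝ)
    (D : PMF (Clustering G)) : Prop :=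
  1 - δ ≤ D.toMeasure.real {P | P.HasRadius w r} ∧
    ∀ x y : Fin n, D.toMeasure.real {P | P.center x ≠ P.center y} ≤ a * (wdist G w x y / r)

/-! ### The algorithm

`m` is the number of levels and `g` the number of samples in each level. Levels are numbered from
`0`, so level `i : Fin m` is step `i + 1` of the algorithm and has radius `ρ ^ (i + 1)`. -/

/-- The unit flow along a walk: `+1` for each traversal of an edge in its direction, `-1` for each
traversal against it. -/
def walkFlow {n : ℕ} {G : SimpleGraph (Fin n)} {u v : Fin n} (p : G.Walk u v)
    (e : DirEdge G) : ℝ :=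
  ((p.darts.map fun a => a.toProd).count e.1 : ℝ) -
    ((p.darts.map fun a => a.toProd).count e.1.swap : ℝ)

/-- The demand after one step: each `v` sends `d v / g` to its center in each of the `g` sampled
clusterings. -/
def nextDemand {n g : ℕ} {G : SimpleGraph (Fin n)} (P : Fin g → Clustering G) (d : Fin n → ℝ) :
    Fin n → ℝ :=
  fun u => ∑ j, ∑ v, if (P j).center v = u then (1 / (g : ℝ)) * d v else 0

/-- The demand `d_k` that remains after the first `k` steps, starting from `d_0 = d`. -/
def demandAfter {n m g : ℕ} {G : SimpleGraph (Fin n)} (ω : Fin m × Fin g → Clustering G)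
    (d : Fin n → ℝ) : ℕ → Fin n → ℝ
  | 0 => d
  | k + 1 =>
    if h : k < m then nextDemand (fun j => ω (⟨k, h⟩, j)) (demandAfter ω d k)
    else demandAfter ω d k

/-- The arbitrary choices of the algorithm, given the sampled clusterings `ω`: the paths to the
centers, and the spanning tree with its root. -/
structure Choices {n m g : ℕ} {G : SimpleGraph (Fin n)} (w : Sym2 (Fin n) → ℝ) (ρ : ℝ)
    (ω : Fin m × Fin g → Clustering G) where
  path : ∀ (i : Fin m) (j : Fin g) (v : Fin n), G.Walk v ((ω (i, j)).center v)
  path_isPath : ∀ i j v, (path i j v).IsPath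
  path_length : ∀ i j v, walkLength w (path i j v) ≤ ρ ^ ((i : ℕ) + 1)
  tree : SimpleGraph (Fin n)
  tree_le : tree ≤ G
  tree_isTree : tree.IsTree
  root : Fin n
  treePath : ∀ v : Fin n, G.Walk v root
  treePath_isPath : ∀ v, (treePath v).IsPath
  treePath_edges : ∀ v, ∀ e ∈ (treePath v).edges, e ∈ tree.edgeSet

/-- The total flow that the algorithm sends on the demand `d`. -/
def outputFlow {n m g : ℕ} {G : SimpleGraph (Fin n)} {w : Sym2 (Fin n) → ℝ} {ρ : ℝ}
    {ω : Fin m × Fin g → Clustering G} (c : Choices w ρ ω) (d : Fin n → ℝ) : DirEdge G → ℝ :=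
  fun e =>
    (∑ i : Fin m, ∑ j : Fin g, ∑ v,
      (1 / (g : ℝ)) * demandAfter ω d i v * walkFlow (c.path i j v) e) +
    ∑ v, demandAfter ω d m v * walkFlow (c.treePath v) e

/-- `R` is a possible output of the algorithm for the sampled clusterings `ω`: for some choices, the
algorithm routes every demand `d` by the flow `R d`. -/
def IsOutput {n m g : ℕ} {G : SimpleGraph (Fin n)} (w : Sym2 (Fin n) → ℝ) (ρ : ℝ)
    (ω : Fin m × Fin g → Clustering G) (R : Matrix (DirEdge G) (Fin n) ℝ) : Prop :=
  ∃ c : Choices w ρ ω, ∀ d : Fin n → ℝ, R.mulVec d = outputFlow c d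

/-- The run succeeds with approximation `a`: the algorithm can be carried out on the samples `ω`, and
whatever choices it makes, it outputs an `a`-approximate `ℓ₁`-oblivious routing. -/
def Succeeds {n m g : ℕ} (G : SimpleGraph (Fin n)) (w : Sym2 (Fin n) → ℝ) (ρ a : ℝ)
    (ω : Fin m × Fin g → Clustering G) : Prop :=
  (∃ R, IsOutput w ρ ω R) ∧ ∀ R, IsOutput w ρ ω R → IsApproxObliviousRouting G w a R

/-- The law of the samples: all independent, those of level `i` with distribution `D i`. -/
def sampleLaw {n m g : ℕ} {G : SimpleGraph (Fin n)} (D : Fin m → PMF (Clustering G)) :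
    Measure (Fin m × Fin g → Clustering G) :=
  Measure.pi fun q => (D q.1).toMeasure

/-! ### The parameters -/

/-- `exp (c √(log n · log log n))` -/
def quality (c : ℝ) (n : ℕ) : ℝ := Real.exp (c * √(Real.log n * Real.log (Real.log n)))

/-- `exp ((c · log n · log log n) ^ (3/4))` -/
def expThreeQuarters (c : ℝ) (n : ℕ) : ℝ :=
  Real.exp ((c * (Real.log n * Real.log (Real.log n))) ^ (3 / 4 : ℝ))

/-- The number of levels, `(c · log n) ^ (1/4)` rounded up. -/
def numLevels (c : ℝ) (n : ℕ) : ℕ := ⌈(c * Real.log n) ^ (1 / 4 : ℝ)⌉₊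

/-- The number of samples in each level, `c · log n · ρ / α` rounded up. -/
def numSamples (c : ℝ) (n : ℕ) (ρ α : ℝ) : ℕ := ⌈c * Real.log n * (ρ / α)⌉₊

end

end ObliviousRouting

/-! Part (b). An optimal flow is a combination of unit edge flows and the algorithm is linear, so it
suffices to route each edge demand `1_s - 1_t` at cost at most `a * W`, where `W = w s(s, t)`. The
demand left after `k` levels is tracked as a sum of pair demands whose endpoints are at distance at
most `W + 2 k ρ^k` (`Near`). A sample that puts both endpoints of a pair in one part cancels that
pair's mass, so only the separating samples matter. They are a fraction of order `α * distance /
ρ^(k+1)`, and once `ρ^k` exceeds `W` each level multiplies the mass by at most `8 m α / ρ`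
(`near_demandAfter`). Hence after `k` levels the mass is at most `W (8 m α / ρ)^k`. Moving it by
`ρ^(k+1)` costs at most `2 ρ (8 m α)^k W`, and the final tree paths, of length at most `n^(C+1) ≤
ρ^m`, are paid for by the last mass bound (`succeeds_of_good`). In total `a` is about `ρ (8 m α)^m`;
with `m` of order `(log n)^(1/4)`, both `ρ` and `α^m` have exponent of order at most `(log n log log
n)^(3/4)`.

The separating fractions are controlled by a Chernoff bound and a union bound over levels and pairs
(`sampleLaw_sepCount_le`, `sampleLaw_good_ge`). Very close pairs have too small a mean for
concentration, so distances are rounded up to `ρ^i`. The bound on the mean is then at least `g α / ρ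
≥ c_g log n`, and the decay of mass is not affected.

Part (a). Balls are carved one after another with truncated geometric radii. Memorylessness makes an
edge that is reached by a ball be cut with probability proportional to its length
(`exists_carving`). This gives quality `8 log n`, well below the allowed bound. -/

namespace ObliviousRouting

/-! ### Flows along walks, weighted distances, and reduction to edge demands. -/

section Flow

variable {n : ℕ} {G : SimpleGraph (Fin n)} {w : Sym2 (Fin n) → ℝ}

theorem cost_eq (f : DirEdge G → ℝ) : cost G w f = ∑ e, |w s(e.1.1, e.1.2) * f e| := by
  simp [cost, weightMatrix, Matrix.mulVec_diagonal]

theorem cost_zero : cost G w 0 = 0 := by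
  simp [cost_eq]

theorem cost_add_le (f f' : DirEdge G → ℝ) : cost G w (f + f') ≤ cost G w f + cost G w f' := by
  simp only [cost_eq, ← Finset.sum_add_distrib, Pi.add_apply, mul_add]
  exact Finset.sum_le_sum fun _ _ => abs_add_le _ _

theorem cost_smul (c : ℝ) (f : DirEdge G → ℝ) : cost G w (c • f) = |c| * cost G w f := by
  simp only [cost_eq, Finset.mul_sum, Pi.smul_apply, smul_eq_mul, abs_mul]
  exact Finset.sum_congr rfl fun _ _ => by ring

theorem cost_sum_le {ι : Type*} (s : Finset ι) (f : ι → DirEdge G → ℝ) :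
    cost G w (∑ i ∈ s, f i) ≤ ∑ i ∈ s, cost G w (f i) := by
  classical
  induction s using Finset.induction_on with
  | empty => simp [cost_zero]
  | insert a s ha ih =>
    rw [Finset.sum_insert ha, Finset.sum_insert ha]
    exact (cost_add_le _ _).trans (by gcongr)

/-- The unit flow along a single edge traversed from `u` to `v`. -/
def stepFlow (G : SimpleGraph (Fin n)) (u v : Fin n) (e : DirEdge G) : ℝ :=
  (if (u, v) = e.1 then 1 else 0) - (if (u, v) = e.1.swap then 1 else 0)

theorem walkFlow_nil (u : Fin n) : walkFlow (SimpleGraph.Walk.nil : G.Walk u u) = 0 := by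
  ext e
  simp [walkFlow]

theorem walkFlow_cons {u v x : Fin n} (h : G.Adj u v) (p : G.Walk v x) :
    walkFlow (SimpleGraph.Walk.cons h p) = stepFlow G u v + walkFlow p := by
  ext e
  simp only [walkFlow, stepFlow, SimpleGraph.Walk.darts_cons, List.map_cons, List.count_cons,
    Pi.add_apply, beq_iff_eq, Nat.cast_add, Nat.cast_ite, Nat.cast_one, Nat.cast_zero]
  ring

theorem stepFlow_of_lt {u v : Fin n} (h : G.Adj u v) (huv : u < v) :
    stepFlow G u v = Pi.single ⟨(u, v), h, huv⟩ 1 := by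
  ext e
  obtain ⟨⟨a, b⟩, hab, hlt⟩ := e
  simp only [stepFlow, Pi.single_apply, Subtype.mk.injEq, Prod.swap_prod_mk, Prod.mk.injEq] at *
  have h2 : ¬ (u = b ∧ v = a) := by rintro ⟨rfl, rfl⟩; exact lt_asymm huv hlt
  rw [if_neg h2, sub_zero]
  congr 1
  simp [eq_comm]

theorem stepFlow_of_gt {u v : Fin n} (h : G.Adj u v) (huv : v < u) :
    stepFlow G u v = -Pi.single ⟨(v, u), h.symm, huv⟩ 1 := by
  ext e
  obtain ⟨⟨a, b⟩, hab, hlt⟩ := e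
  simp only [stepFlow, Pi.neg_apply, Pi.single_apply, Subtype.mk.injEq, Prod.swap_prod_mk,
    Prod.mk.injEq] at *
  have h2 : ¬ (u = a ∧ v = b) := by rintro ⟨rfl, rfl⟩; exact lt_asymm huv hlt
  rw [if_neg h2, zero_sub]
  congr 2
  apply propext
  constructor <;> (rintro ⟨rfl, rfl⟩; exact ⟨rfl, rfl⟩)

theorem incidence_mulVec_single (e : DirEdge G) :
    (incidence G).mulVec (Pi.single e 1) = Pi.single e.1.1 1 - Pi.single e.1.2 1 := by
  ext v
  have hne : e.1.1 ≠ e.1.2 := e.2.2.ne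
  rw [Matrix.mulVec_single_one]
  simp only [Matrix.col_apply, incidence, Matrix.of_apply, Pi.sub_apply, Pi.single_apply]
  by_cases h1 : v = e.1.1
  · have : v ≠ e.1.2 := fun h => hne (h1 ▸ h)
    simp [h1, hne]
  · simp only [h1, if_false]
    split_ifs <;> simp

theorem cost_single (e : DirEdge G) (hw : 0 ≤ w s(e.1.1, e.1.2)) :
    cost G w (Pi.single e 1) = w s(e.1.1, e.1.2) := by
  rw [cost_eq, Finset.sum_eq_single e]
  · simp [abs_of_nonneg hw]
  · intro b _ hb
    simp [hb]
  · simp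

theorem incidence_mulVec_stepFlow {u v : Fin n} (h : G.Adj u v) :
    (incidence G).mulVec (stepFlow G u v) = Pi.single u 1 - Pi.single v 1 := by
  rcases lt_or_gt_of_ne h.ne with huv | huv
  · rw [stepFlow_of_lt h huv, incidence_mulVec_single]
  · rw [stepFlow_of_gt h huv, Matrix.mulVec_neg, incidence_mulVec_single, neg_sub]

theorem cost_stepFlow {u v : Fin n} (h : G.Adj u v) (hw : 0 ≤ w s(u, v)) :
    cost G w (stepFlow G u v) = w s(u, v) := by
  rcases lt_or_gt_of_ne h.ne with huv | huv
  · rw [stepFlow_of_lt h huv, cost_single _ hw]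
  · have hw' : 0 ≤ w s(v, u) := by rwa [Sym2.eq_swap]
    rw [stepFlow_of_gt h huv, ← neg_one_smul ℝ, cost_smul, cost_single _ hw', Sym2.eq_swap]
    simp

theorem incidence_mulVec_walkFlow {u v : Fin n} (p : G.Walk u v) :
    (incidence G).mulVec (walkFlow p) = Pi.single u 1 - Pi.single v 1 := by
  induction p with
  | nil => simp [walkFlow_nil]
  | cons h p ih =>
    rw [walkFlow_cons, Matrix.mulVec_add, ih, incidence_mulVec_stepFlow h, sub_add_sub_cancel]

theorem walkLength_nil (u : Fin n) : walkLength w (SimpleGraph.Walk.nil : G.Walk u u) = 0 := by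
  simp [walkLength]

theorem walkLength_cons {u v x : Fin n} (h : G.Adj u v) (p : G.Walk v x) :
    walkLength w (SimpleGraph.Walk.cons h p) = w s(u, v) + walkLength w p := by
  simp [walkLength]

theorem walkLength_append {u v x : Fin n} (p : G.Walk u v) (q : G.Walk v x) :
    walkLength w (p.append q) = walkLength w p + walkLength w q := by
  simp [walkLength, SimpleGraph.Walk.edges_append]

theorem walkLength_reverse {u v : Fin n} (p : G.Walk u v) :
    walkLength w p.reverse = walkLength w p := by
  simp [walkLength, SimpleGraph.Walk.edges_reverse, List.sum_reverse]

theorem walkLength_nonneg (hw : ∀ e ∈ G.edgeSet, 0 ≤ w e) {u v : Fin n} (p : G.Walk u v) :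
    0 ≤ walkLength w p := by
  apply List.sum_nonneg
  intro x hx
  obtain ⟨e, he, rfl⟩ := List.mem_map.1 hx
  exact hw e (p.edges_subset_edgeSet he)

theorem cost_walkFlow_le (hw : ∀ e ∈ G.edgeSet, 0 ≤ w e) {u v : Fin n} (p : G.Walk u v) :
    cost G w (walkFlow p) ≤ walkLength w p := by
  induction p with
  | nil => simp [walkFlow_nil, cost_zero, walkLength_nil]
  | cons h p ih =>
    rw [walkFlow_cons, walkLength_cons]
    exact (cost_add_le _ _).trans (add_le_add (cost_stepFlow h (hw _ h)).le ih)

theorem walkLength_bypass_le (hw : ∀ e ∈ G.edgeSet, 0 ≤ w e) {u v : Fin n} (p : G.Walk u v) :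
    walkLength w p.bypass ≤ walkLength w p := by
  refine (p.edges_bypass_sublist_edges.map w).sum_le_sum fun x hx => ?_
  obtain ⟨e, he, rfl⟩ := List.mem_map.1 hx
  exact hw e (p.edges_subset_edgeSet he)

theorem walkLength_isPath_le {b : ℝ} (hw : ∀ e ∈ G.edgeSet, w e ≤ b) (hb : 0 ≤ b) {u v : Fin n}
    (p : G.Walk u v) (hp : p.IsPath) : walkLength w p ≤ n * b := by
  have h1 : walkLength w p ≤ (p.edges.map w).length • b := by
    apply List.sum_le_card_nsmul
    intro x hx
    obtain ⟨e, he, rfl⟩ := List.mem_map.1 hx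
    exact hw e (p.edges_subset_edgeSet he)
  have h2 : p.length < n := by simpa using hp.length_lt
  rw [List.length_map, SimpleGraph.Walk.length_edges, nsmul_eq_mul] at h1
  exact h1.trans (by gcongr)

theorem wdist_le (hw : ∀ e ∈ G.edgeSet, 0 ≤ w e) {u v : Fin n} (p : G.Walk u v) :
    wdist G w u v ≤ walkLength w p :=
  ciInf_le ⟨0, by rintro _ ⟨q, rfl⟩; exact walkLength_nonneg hw q⟩ p

theorem wdist_le_of_adj (hw : ∀ e ∈ G.edgeSet, 0 ≤ w e) {u v : Fin n} (h : G.Adj u v) :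
    wdist G w u v ≤ w s(u, v) := by
  simpa [walkLength] using wdist_le hw h.toWalk

theorem wdist_nonneg (hw : ∀ e ∈ G.edgeSet, 0 ≤ w e) (u v : Fin n) : 0 ≤ wdist G w u v :=
  Real.iInf_nonneg fun p => walkLength_nonneg hw p

theorem wdist_le_add_walkLength (hG : G.Connected) (hw : ∀ e ∈ G.edgeSet, 0 ≤ w e)
    {x y x' y' : Fin n} (p : G.Walk x x') (q : G.Walk y y') :
    wdist G w x' y' ≤ walkLength w p + wdist G w x y + walkLength w q := by
  have : Nonempty (G.Walk x y) := hG.preconnected x y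
  have : wdist G w x' y' - walkLength w p - walkLength w q ≤ wdist G w x y := by
    apply le_ciInf
    intro s
    have := wdist_le hw ((p.reverse.append s).append q)
    rw [walkLength_append, walkLength_append, walkLength_reverse] at this
    linarith
  linarith

/-- If every edge demand is routed at cost at most `a` times its weight, then every proper demand is
routed at cost at most `a` times the optimum. -/
theorem IsObliviousRouting.isApprox_of_edge {R : Matrix (DirEdge G) (Fin n) ℝ}
    (hR : IsObliviousRouting G R) {a : ℝ} (ha : 0 ≤ a) (hw : ∀ e ∈ G.edgeSet, 0 ≤ w e)
    (h : ∀ e : DirEdge G,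
      cost G w (R.mulVec (Pi.single e.1.1 1 - Pi.single e.1.2 1)) ≤ a * w s(e.1.1, e.1.2)) :
    IsApproxObliviousRouting G w a R := by
  refine ⟨hR, fun d hd => ?_⟩
  have : Nonempty {f : DirEdge G → ℝ // Routes G f d} := ⟨⟨_, hR d hd⟩⟩
  rw [opt, Real.mul_iInf_of_nonneg ha]
  apply le_ciInf
  rintro ⟨f, hf⟩
  -- Applying the incidence matrix to any flow that routes `d` writes `d` as a combination of edge
  -- demands, with total weighted coefficient equal to the cost of the flow.
  have hd' : d = ∑ e, f e • (Pi.single e.1.1 1 - Pi.single e.1.2 1 : Fin n → ℝ) := by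
    rw [← hf, show f = ∑ e, f e • (Pi.single e 1 : DirEdge G → ℝ) from by
      ext x; simp [Finset.sum_apply, Pi.single_apply], Matrix.mulVec_sum]
    refine Finset.sum_congr rfl fun e _ => ?_
    rw [Matrix.mulVec_smul, incidence_mulVec_single]
    simp [Finset.sum_apply, Pi.single_apply]
  rw [show cost G w (R.mulVec d) = cost G w (R.mulVec _) from congrArg _ (congrArg _ hd'),
    Matrix.mulVec_sum]
  refine (cost_sum_le _ _).trans ?_
  rw [cost_eq, Finset.mul_sum]
  refine Finset.sum_le_sum fun e _ => ?_
  rw [Matrix.mulVec_smul, cost_smul, abs_mul, abs_of_nonneg (hw _ e.2.1)]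
  calc _ ≤ |f e| * (a * w s(e.1.1, e.1.2)) := by gcongr; exact h e
    _ = _ := by ring

end Flow

/-! ### Demands as sums of short pairs, and their evolution under one step. -/

section Transport

variable {n : ℕ} {G : SimpleGraph (Fin n)} {w : Sym2 (Fin n) → ℝ}

/-- `Near G w D M d` says that `d` is a sum of demands between pairs of vertices at distance at most
`D`, of total mass at most `M`. -/
inductive Near (G : SimpleGraph (Fin n)) (w : Sym2 (Fin n) → ℝ) (D : ℝ) :
    ℝ → (Fin n → ℝ) → Prop
  | zero {M : ℝ} : 0 ≤ M → Near G w D M 0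
  | pair {l : ℝ} (x y : Fin n) : 0 ≤ l → wdist G w x y ≤ D →
      Near G w D l (l • (Pi.single x 1 - Pi.single y 1))
  | add {M M' : ℝ} {d d' : Fin n → ℝ} : Near G w D M d → Near G w D M' d' →
      Near G w D (M + M') (d + d')

theorem Near.mono {D M M' : ℝ} {d : Fin n → ℝ} (h : Near G w D M d) (hM : M ≤ M') :
    Near G w D M' d := by
  have := h.add (Near.zero (G := G) (w := w) (D := D) (sub_nonneg.2 hM))
  rwa [add_zero, add_sub_cancel] at this

theorem Near.mono_dist {D D' M : ℝ} {d : Fin n → ℝ} (h : Near G w D M d) (hD : D ≤ D') :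
    Near G w D' M d := by
  induction h with
  | zero h => exact .zero h
  | pair x y h h' => exact .pair x y h (h'.trans hD)
  | add _ _ h h' => exact h.add h'

theorem Near.sum {ι : Type*} {D : ℝ} (s : Finset ι) {M : ι → ℝ} {d : ι → Fin n → ℝ}
    (h : ∀ i ∈ s, Near G w D (M i) (d i)) : Near G w D (∑ i ∈ s, M i) (∑ i ∈ s, d i) := by
  classical
  induction s using Finset.induction_on with
  | empty => exact .zero le_rfl
  | insert a s ha ih =>
    rw [Finset.sum_insert ha, Finset.sum_insert ha]
    exact (h a (by simp)).add (ih fun i hi => h i (by simp [hi]))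

theorem Near.sum_abs_le {D M : ℝ} {d : Fin n → ℝ} (h : Near G w D M d) : ∑ v, |d v| ≤ 2 * M := by
  induction h with
  | zero h => simpa using h
  | @pair l x y h _ =>
    calc ∑ v, |(l • (Pi.single x 1 - Pi.single y 1 : Fin n → ℝ)) v|
        ≤ ∑ v, (l * (Pi.single x 1 : Fin n → ℝ) v + l * (Pi.single y 1 : Fin n → ℝ) v) := by
          refine Finset.sum_le_sum fun v _ => ?_
          rw [Pi.smul_apply, smul_eq_mul, abs_mul, abs_of_nonneg h, ← mul_add]
          refine mul_le_mul_of_nonneg_left ((abs_sub _ _).trans ?_) h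
          simp only [Pi.single_apply]
          split_ifs <;> simp
      _ = 2 * l := by
          rw [Finset.sum_add_distrib, ← Finset.mul_sum, ← Finset.mul_sum]
          simp [Pi.single_apply]; ring
  | add _ _ h h' =>
    rw [mul_add]
    refine le_trans ?_ (add_le_add h h')
    rw [← Finset.sum_add_distrib]
    exact Finset.sum_le_sum fun v _ => abs_add_le _ _

variable {g : ℕ}

theorem nextDemand_eq (P : Fin g → Clustering G) (d : Fin n → ℝ) :
    nextDemand P d =
      ∑ j, ∑ v, (1 / (g : ℝ) * d v) • (Pi.single ((P j).center v) 1 : Fin n → ℝ) := by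
  ext u
  simp [nextDemand, Finset.sum_apply, Pi.single_apply, eq_comm]

theorem nextDemand_add (P : Fin g → Clustering G) (d d' : Fin n → ℝ) :
    nextDemand P (d + d') = nextDemand P d + nextDemand P d' := by
  simp [nextDemand_eq, mul_add, add_smul, Finset.sum_add_distrib]

theorem nextDemand_smul (P : Fin g → Clustering G) (a : ℝ) (d : Fin n → ℝ) :
    nextDemand P (a • d) = a • nextDemand P d := by
  simp only [nextDemand_eq, Finset.smul_sum, Pi.smul_apply, smul_eq_mul, smul_smul]
  refine Finset.sum_congr rfl fun j _ => Finset.sum_congr rfl fun v _ => ?_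
  ring_nf

theorem nextDemand_single_sub (P : Fin g → Clustering G) (x y : Fin n) :
    nextDemand P (Pi.single x 1 - Pi.single y 1) =
      ∑ j, (1 / (g : ℝ)) • (Pi.single ((P j).center x) 1 - Pi.single ((P j).center y) 1) := by
  rw [nextDemand_eq]
  refine Finset.sum_congr rfl fun j _ => ?_
  simp [mul_sub, sub_smul, Finset.sum_sub_distrib, Pi.single_apply, smul_sub]

theorem sum_nextDemand (hg : 0 < g) (P : Fin g → Clustering G) (d : Fin n → ℝ) :
    ∑ v, nextDemand P d v = ∑ v, d v := by
  have hg' : (g : ℝ) ≠ 0 := by positivity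
  simp only [nextDemand]
  rw [Finset.sum_comm]
  calc ∑ j : Fin g, ∑ u, ∑ v, (if (P j).center v = u then 1 / (g : ℝ) * d v else 0)
      = ∑ j : Fin g, ∑ v, 1 / (g : ℝ) * d v := by
        refine Finset.sum_congr rfl fun j _ => ?_
        rw [Finset.sum_comm]
        simp
    _ = _ := by
        rw [Finset.sum_const, ← Finset.mul_sum]
        simp [hg']

/-- The number of clusterings that separate `x` and `y`. -/
def sepCount (P : Fin g → Clustering G) (x y : Fin n) : ℕ :=
  (Finset.univ.filter fun j => (P j).center x ≠ (P j).center y).card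

theorem sepCount_le (P : Fin g → Clustering G) (x y : Fin n) : sepCount P x y ≤ g :=
  (Finset.card_filter_le _ _).trans (by simp)

/-- A sample that does not separate a pair sends both of its endpoints to the same center, where
they cancel. Each separating sample keeps a share `1 / g` of the mass, between two centers that are
each at most `r` away from the old endpoints. -/
theorem Near.nextDemand (hG : G.Connected) (hw : ∀ e ∈ G.edgeSet, 0 ≤ w e)
    {P : Fin g → Clustering G} {r D M φ : ℝ} {d : Fin n → ℝ} (hg : 0 < g)
    (hr : ∀ j, (P j).HasRadius w r) (hφ0 : 0 ≤ φ)
    (hφ : ∀ x y, wdist G w x y ≤ D → (sepCount P x y : ℝ) ≤ φ * g) (h : Near G w D M d) :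
    Near G w (D + 2 * r) (φ * M) (nextDemand P d) := by
  induction h with
  | @zero M h =>
    have : ObliviousRouting.nextDemand P (0 : Fin n → ℝ) = 0 := by simp [nextDemand_eq]
    rw [this]
    exact .zero (mul_nonneg hφ0 h)
  | @pair l x y h hxy =>
    have hg' : (0 : ℝ) < g := by positivity
    rw [nextDemand_smul, nextDemand_single_sub, Finset.smul_sum,
      ← Finset.sum_filter_add_sum_filter_not _ fun j => (P j).center x ≠ (P j).center y]
    rw [Finset.sum_eq_zero (s := Finset.univ.filter fun j => ¬ (P j).center x ≠ (P j).center y)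
      (fun j hj => by simp at hj; simp [hj]), add_zero]
    refine Near.mono (Near.sum _ (M := fun _ => l * (1 / g)) fun j _ => ?_) ?_
    · rw [smul_smul]
      refine .pair _ _ (by positivity) ?_
      obtain ⟨p, -, hp⟩ := hr j x
      obtain ⟨q, -, hq⟩ := hr j y
      linarith [wdist_le_add_walkLength hG hw p q]
    · rw [Finset.sum_const, nsmul_eq_mul]
      have := hφ x y hxy
      rw [sepCount] at this
      calc _ ≤ φ * g * (l * (1 / g)) := by gcongr
        _ = φ * l := by field_simp
  | add _ _ h h' =>
    rw [mul_add, nextDemand_add]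
    exact h.add h'

end Transport

/-! ### Linearity, correctness and cost of the output flow. -/

section Output

variable {n m g : ℕ} {G : SimpleGraph (Fin n)} {w : Sym2 (Fin n) → ℝ} {ρ : ℝ}
  {ω : Fin m × Fin g → Clustering G}

theorem demandAfter_succ (d : Fin n → ℝ) (i : Fin m) :
    demandAfter ω d (i + 1) = nextDemand (fun j => ω (i, j)) (demandAfter ω d i) := by
  simp [demandAfter]

theorem demandAfter_add (d d' : Fin n → ℝ) (k : ℕ) :
    demandAfter ω (d + d') k = demandAfter ω d k + demandAfter ω d' k := by
  induction k with
  | zero => rfl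
  | succ k ih =>
    simp only [demandAfter]
    split_ifs
    · rw [ih, nextDemand_add]
    · exact ih

theorem demandAfter_smul (a : ℝ) (d : Fin n → ℝ) (k : ℕ) :
    demandAfter ω (a • d) k = a • demandAfter ω d k := by
  induction k with
  | zero => rfl
  | succ k ih =>
    simp only [demandAfter]
    split_ifs
    · rw [ih, nextDemand_smul]
    · exact ih

theorem sum_demandAfter (hg : 0 < g) (d : Fin n → ℝ) (k : ℕ) :
    ∑ v, demandAfter ω d k v = ∑ v, d v := by
  induction k with
  | zero => rfl
  | succ k ih =>
    simp only [demandAfter]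
    split_ifs
    · rw [sum_nextDemand hg, ih]
    · exact ih

theorem outputFlow_eq (c : Choices w ρ ω) (d : Fin n → ℝ) :
    outputFlow c d =
      (∑ i : Fin m, ∑ j : Fin g, ∑ v, (1 / (g : ℝ) * demandAfter ω d i v) • walkFlow (c.path i j v))
        + ∑ v, demandAfter ω d m v • walkFlow (c.treePath v) := by
  ext e
  simp [outputFlow, Finset.sum_apply]

/-- The choices do not depend on the demand, so the flow is linear in it and is given by a matrix.
-/
theorem exists_isOutput (c : Choices w ρ ω) : ∃ R, IsOutput w ρ ω R := by
  let f : (Fin n → ℝ) →ₗ[ℝ] (DirEdge G → ℝ) :=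
    { toFun := outputFlow c
      map_add' := fun d d' => by
        simp only [outputFlow_eq, demandAfter_add, Pi.add_apply, mul_add, add_smul,
          Finset.sum_add_distrib]
        abel
      map_smul' := fun a d => by
        simp only [outputFlow_eq, demandAfter_smul, Pi.smul_apply, smul_eq_mul, smul_add,
          Finset.smul_sum, smul_smul, RingHom.id_apply, mul_left_comm] }
  exact ⟨LinearMap.toMatrix' f, c, fun d => by rw [LinearMap.toMatrix'_mulVec]; rfl⟩

theorem nonempty_choices (hG : G.Connected) (hw : ∀ e ∈ G.edgeSet, 0 ≤ w e)
    (h : ∀ (i : Fin m) (j : Fin g), (ω (i, j)).HasRadius w (ρ ^ ((i : ℕ) + 1))) :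
    Nonempty (Choices w ρ ω) := by
  obtain ⟨T, hT, hTree⟩ := hG.exists_isTree_le
  choose p _ hp using h
  have root : Fin n := hG.nonempty.some
  choose q hq using fun v => hTree.connected.exists_isPath v root
  exact ⟨{
    path := fun i j v => (p i j v).bypass
    path_isPath := fun i j v => (p i j v).bypass_isPath
    path_length := fun i j v => (walkLength_bypass_le hw _).trans (hp i j v)
    tree := T
    tree_le := hT
    tree_isTree := hTree
    root := root
    treePath := fun v => (q v).mapLe hT
    treePath_isPath := fun v => (hq v).mapLe hT
    treePath_edges := fun v e he => by
      rw [SimpleGraph.Walk.edges_mapLe_eq_edges] at he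
      exact (q v).edges_subset_edgeSet he }⟩

/-- The flow of level `i` has divergence `d_i - d_(i+1)`, and these telescope. The tree flow has
divergence `d_m`, because a proper demand leaves nothing at the root. -/
theorem routes_outputFlow (hg : 0 < g) (c : Choices w ρ ω) {d : Fin n → ℝ} (hd : IsProper d) :
    Routes G (outputFlow c d) d := by
  have hg' : (g : ℝ) ≠ 0 := by positivity
  have hself : ∀ d : Fin n → ℝ, ∑ v, d v • (Pi.single v 1 : Fin n → ℝ) = d := fun d => by
    ext u; simp [Finset.sum_apply, Pi.single_apply]
  have h1 : ∀ i : Fin m, (∑ j : Fin g, ∑ v, (incidence G).mulVec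
      ((1 / (g : ℝ) * demandAfter ω d i v) • walkFlow (c.path i j v))) =
      demandAfter ω d i - demandAfter ω d (i + 1) := fun i => by
    simp only [Matrix.mulVec_smul, incidence_mulVec_walkFlow, smul_sub, Finset.sum_sub_distrib]
    rw [demandAfter_succ, nextDemand_eq]
    congr 1
    simp only [← smul_smul, ← Finset.smul_sum, hself]
    rw [Finset.sum_const, Finset.card_univ, Fintype.card_fin, ← Nat.cast_smul_eq_nsmul ℝ, smul_smul,
      one_div_mul_cancel hg', one_smul]
  have h2 : (∑ v, (incidence G).mulVec (demandAfter ω d m v • walkFlow (c.treePath v))) =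
      demandAfter ω d m := by
    simp only [Matrix.mulVec_smul, incidence_mulVec_walkFlow, smul_sub, Finset.sum_sub_distrib,
      hself, ← Finset.sum_smul]
    rw [sum_demandAfter hg, show ∑ v, d v = 0 from hd]
    simp
  rw [Routes, outputFlow_eq, Matrix.mulVec_add]
  simp only [Matrix.mulVec_sum]
  rw [h2, Finset.sum_congr rfl fun i _ => h1 i,
    Fin.sum_univ_eq_sum_range fun i => demandAfter ω d i - demandAfter ω d (i + 1),
    Finset.sum_range_sub']
  simp [demandAfter]

theorem cost_outputFlow_le (hw : ∀ e ∈ G.edgeSet, 0 ≤ w e) (hg : 0 < g) (c : Choices w ρ ω)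
    {L : ℝ} (hL : ∀ v, walkLength w (c.treePath v) ≤ L) (d : Fin n → ℝ) :
    cost G w (outputFlow c d) ≤
      (∑ i : Fin m, ρ ^ ((i : ℕ) + 1) * ∑ v, |demandAfter ω d i v|) +
        L * ∑ v, |demandAfter ω d m v| := by
  have hg' : (g : ℝ) ≠ 0 := by positivity
  rw [outputFlow_eq]
  refine (cost_add_le _ _).trans (add_le_add ?_ ?_)
  · refine (cost_sum_le _ _).trans (Finset.sum_le_sum fun i _ => ?_)
    refine (cost_sum_le _ _).trans ?_
    have : ρ ^ ((i : ℕ) + 1) * ∑ v, |demandAfter ω d i v| =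
        ∑ _j : Fin g, 1 / (g : ℝ) * (ρ ^ ((i : ℕ) + 1) * ∑ v, |demandAfter ω d i v|) := by
      rw [Finset.sum_const, Finset.card_univ, Fintype.card_fin, nsmul_eq_mul, ← mul_assoc,
        mul_one_div_cancel hg', one_mul]
    rw [this]
    refine Finset.sum_le_sum fun j _ => (cost_sum_le _ _).trans ?_
    rw [Finset.mul_sum, Finset.mul_sum]
    refine Finset.sum_le_sum fun v _ => ?_
    rw [cost_smul, abs_mul, abs_of_nonneg (by positivity : (0 : ℝ) ≤ 1 / g), mul_assoc,
      mul_comm (ρ ^ _)]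
    gcongr
    exact (cost_walkFlow_le hw _).trans (c.path_length i j v)
  · refine (cost_sum_le _ _).trans ?_
    rw [Finset.mul_sum]
    refine Finset.sum_le_sum fun v _ => ?_
    rw [cost_smul, mul_comm]
    gcongr
    exact (cost_walkFlow_le hw _).trans (hL v)

end Output

/-! ### Approximation guarantee for good samples. -/

section Success

variable {n m g : ℕ} {G : SimpleGraph (Fin n)} {w : Sym2 (Fin n) → ℝ} {ρ α : ℝ}
  {ω : Fin m × Fin g → Clustering G}

/-- The crude mass bound `1` is carried along because mass need not decay while `ρ^k` is below the
edge weight. At those levels the second bound is rederived from it. -/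
theorem near_demandAfter (hG : G.Connected) (hw : ∀ e ∈ G.edgeSet, 1 ≤ w e) (hg : 0 < g)
    (hρ : 1 ≤ ρ) (hα : 1 ≤ α)
    (hrad : ∀ (i : Fin m) (j : Fin g), (ω (i, j)).HasRadius w (ρ ^ ((i : ℕ) + 1)))
    (hsep : ∀ (i : Fin m) (x y : Fin n), (sepCount (fun j => ω (i, j)) x y : ℝ) ≤
      4 * (α * max (wdist G w x y) (ρ ^ (i : ℕ)) / ρ ^ ((i : ℕ) + 1)) * g)
    {s t : Fin n} (h : G.Adj s t) (k : ℕ) (hk : k ≤ m) :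
    Near G w (w s(s, t) + 2 * k * ρ ^ k) 1
        (demandAfter ω (Pi.single s 1 - Pi.single t 1) k) ∧
      Near G w (w s(s, t) + 2 * k * ρ ^ k) (w s(s, t) * (8 * m * α / ρ) ^ k)
        (demandAfter ω (Pi.single s 1 - Pi.single t 1) k) := by
  have hw0 : ∀ e ∈ G.edgeSet, 0 ≤ w e := fun e he => zero_le_one.trans (hw e he)
  have hW : 1 ≤ w s(s, t) := hw _ h
  set W := w s(s, t)
  induction k with
  | zero =>
    have : Near G w (W + 2 * (0 : ℕ) * ρ ^ 0) 1
        (demandAfter ω (Pi.single s 1 - Pi.single t 1) 0) := by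
      have := Near.pair (G := G) (w := w) (D := W) s t zero_le_one (wdist_le_of_adj hw0 h)
      simpa [demandAfter] using this
    exact ⟨this, this.mono (by simpa using hW)⟩
  | succ k ih =>
    obtain ⟨ih1, ih2⟩ := ih (by omega)
    have hkm : k < m := hk
    have hm : (k : ℝ) + 1 ≤ m := by exact_mod_cast hk
    have hk0 : (0 : ℝ) ≤ k := k.cast_nonneg
    have hρk : 1 ≤ ρ ^ k := one_le_pow₀ hρ
    have hD : W + 2 * k * ρ ^ k + 2 * ρ ^ (k + 1) ≤
        W + 2 * (k + 1 : ℕ) * ρ ^ (k + 1) := by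
      have : ρ ^ k ≤ ρ ^ (k + 1) := pow_le_pow_right₀ hρ (by omega)
      have := mul_le_mul_of_nonneg_left this hk0
      push_cast
      linarith
    have hd := demandAfter_succ (ω := ω) (Pi.single s 1 - Pi.single t 1) ⟨k, hkm⟩
    rw [show demandAfter ω (Pi.single s 1 - Pi.single t 1) (k + 1) = _ from hd]
    have hstep : ∀ (φ M : ℝ), 0 ≤ φ → (∀ x y, wdist G w x y ≤ W + 2 * k * ρ ^ k →
        (sepCount (fun j => ω (⟨k, hkm⟩, j)) x y : ℝ) ≤ φ * g) →
        Near G w (W + 2 * k * ρ ^ k) M (demandAfter ω (Pi.single s 1 - Pi.single t 1) k) →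
        Near G w (W + 2 * (k + 1 : ℕ) * ρ ^ (k + 1)) (φ * M)
          (nextDemand (fun j => ω (⟨k, hkm⟩, j))
            (demandAfter ω (Pi.single s 1 - Pi.single t 1) k)) :=
      fun φ M hφ0 hφ hN => (Near.nextDemand hG hw0 hg (hrad ⟨k, hkm⟩) hφ0 hφ hN).mono_dist hD
    constructor
    · have := hstep 1 1 zero_le_one (fun x y _ => by
        rw [one_mul]; exact_mod_cast sepCount_le _ x y) ih1
      rwa [one_mul] at this
    · have hφ : ∀ B, W + 2 * k * ρ ^ k ≤ B → ∀ x y, wdist G w x y ≤ W + 2 * k * ρ ^ k →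
          (sepCount (fun j => ω (⟨k, hkm⟩, j)) x y : ℝ) ≤ 4 * (α * B / ρ ^ (k + 1)) * g := by
        intro B hB x y hxy
        refine (hsep ⟨k, hkm⟩ x y).trans ?_
        -- For `k ≥ 1` the term `2 k ρ^k` in the distance bound covers the floor `ρ^k`; for `k = 0`
        -- the floor is `1`, which is covered by `W ≥ 1`.
        have hmax : max (wdist G w x y) (ρ ^ k) ≤ B ∨ k = 0 := by
          rcases Nat.eq_zero_or_pos k with h0 | h0
          · exact .inr h0
          · refine .inl (max_le (hxy.trans hB) ?_)
            have : (1 : ℝ) ≤ k := by exact_mod_cast h0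
            nlinarith
        have hmax : max (wdist G w x y) (ρ ^ k) ≤ B := by
          rcases hmax with h | rfl
          · exact h
          · exact max_le (hxy.trans hB) (by simp at hB ⊢; linarith)
        dsimp only
        gcongr
      have hρ0 : 0 < ρ := by linarith
      by_cases hWk : W ≤ ρ ^ k
      -- Here `W + 2 k ρ^k ≤ (2 k + 1) ρ^k ≤ 2 m ρ^k`, so the separated fraction is at most `8 m α /
      -- ρ`, exactly one more factor.
      · refine (hstep _ _ (by positivity) (hφ (2 * m * ρ ^ k) (by nlinarith)) ih2).mono ?_
        apply le_of_eq
        rw [pow_succ (8 * m * α / ρ), pow_succ ρ]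
        field_simp
        ring
      -- Here distances are at most `2 m W`, and mass `1` becomes `8 m α W / ρ^(k+1)`. This is
      -- within the claim because `8 m α ≥ 1`.
      · push Not at hWk
        refine (hstep _ _ (by positivity) (hφ (2 * m * W) (by nlinarith)) ih1).mono ?_
        have hβ : (1 : ℝ) ≤ 8 * m * α := by nlinarith
        have : 8 * m * α ≤ (8 * m * α) ^ (k + 1) := le_self_pow₀ hβ (by omega)
        rw [div_pow]
        calc 4 * (α * (2 * m * W) / ρ ^ (k + 1)) * 1 = W * ((8 * m * α) / ρ ^ (k + 1)) := by ring
          _ ≤ _ := by gcongr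

/-- The factor `ρ^(-k)` in the mass bound cancels the path lengths up to one factor `ρ` per level.
Tree paths have length at most `n * b ≤ ρ^m`, which cancels against the mass after level `m`. -/
theorem succeeds_of_good (hG : G.Connected) {b a : ℝ}
    (hw : ∀ e ∈ G.edgeSet, 1 ≤ w e ∧ w e ≤ b) (hb : 0 ≤ b) (hg : 0 < g) (hm : 0 < m)
    (hρ : 1 ≤ ρ) (hα : 1 ≤ α) (hbm : n * b ≤ ρ ^ m)
    (ha : 2 * (8 * m * α) ^ m * (m * ρ + 1) ≤ a)
    (hrad : ∀ (i : Fin m) (j : Fin g), (ω (i, j)).HasRadius w (ρ ^ ((i : ℕ) + 1)))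
    (hsep : ∀ (i : Fin m) (x y : Fin n), (sepCount (fun j => ω (i, j)) x y : ℝ) ≤
      4 * (α * max (wdist G w x y) (ρ ^ (i : ℕ)) / ρ ^ ((i : ℕ) + 1)) * g) :
    Succeeds G w ρ a ω := by
  have hw0 : ∀ e ∈ G.edgeSet, 0 ≤ w e := fun e he => zero_le_one.trans (hw e he).1
  have hρ0 : 0 < ρ := by linarith
  have hm1 : (1 : ℝ) ≤ m := by exact_mod_cast hm
  have hβ : (1 : ℝ) ≤ 8 * m * α := by nlinarith
  refine ⟨?_, ?_⟩
  · obtain ⟨c⟩ := nonempty_choices hG hw0 hrad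
    exact exists_isOutput c
  rintro R ⟨c, hc⟩
  have hR : IsObliviousRouting G R := fun d hd => by
    rw [hc]
    exact routes_outputFlow hg c hd
  refine hR.isApprox_of_edge (le_trans (by positivity) ha) hw0 fun e => ?_
  rw [hc]
  have hL : ∀ v, walkLength w (c.treePath v) ≤ ρ ^ m := fun v =>
    (walkLength_isPath_le (fun e he => (hw e he).2) hb _ (c.treePath_isPath v)).trans hbm
  refine (cost_outputFlow_le hw0 hg c hL _).trans ?_
  have hW : 1 ≤ w s(e.1.1, e.1.2) := (hw _ e.2.1).1
  have hnorm : ∀ k ≤ m,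
      (∑ v, |demandAfter ω (Pi.single e.1.1 1 - Pi.single e.1.2 1) k v|) * ρ ^ k ≤
        2 * (8 * m * α) ^ m * w s(e.1.1, e.1.2) := by
    intro k hk
    have h1 := (near_demandAfter hG (fun e he => (hw e he).1) hg hρ hα hrad hsep e.2.1 k
      hk).2.sum_abs_le
    calc _ ≤ 2 * (w s(e.1.1, e.1.2) * (8 * m * α / ρ) ^ k) * ρ ^ k := by gcongr
      _ = 2 * (8 * m * α) ^ k * w s(e.1.1, e.1.2) := by rw [div_pow]; field_simp
      _ ≤ _ := by gcongr
  calc _ ≤ (∑ _i : Fin m, ρ * (2 * (8 * m * α) ^ m * w s(e.1.1, e.1.2))) +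
        2 * (8 * m * α) ^ m * w s(e.1.1, e.1.2) := by
        refine add_le_add (Finset.sum_le_sum fun i _ => ?_) ?_
        · have := hnorm i i.2.le
          rw [pow_succ, mul_comm (ρ ^ _), mul_assoc]
          exact mul_le_mul_of_nonneg_left (by rwa [mul_comm]) hρ0.le
        · have := hnorm m le_rfl
          rwa [mul_comm] at this
    _ = 2 * (8 * m * α) ^ m * (m * ρ + 1) * w s(e.1.1, e.1.2) := by
        rw [Finset.sum_const, Finset.card_univ, Fintype.card_fin, nsmul_eq_mul]
        ring
    _ ≤ _ := by gcongr

end Success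

/-! ### Concentration of the number of separating samples. -/

section Sampling

variable {n m g : ℕ} {G : SimpleGraph (Fin n)} {w : Sym2 (Fin n) → ℝ}

instance (D : Fin m → PMF (Clustering G)) : IsProbabilityMeasure (sampleLaw (g := g) D) :=
  inferInstanceAs (IsProbabilityMeasure (Measure.pi fun q : Fin m × Fin g => (D q.1).toMeasure))

theorem sampleLaw_eval (D : Fin m → PMF (Clustering G)) (q : Fin m × Fin g)
    (s : Set (Clustering G)) :
    (sampleLaw D).real {ω | ω q ∈ s} = (D q.1).toMeasure.real s :=
  (measurePreserving_eval (fun q : Fin m × Fin g => (D q.1).toMeasure) q).measureReal_preimage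
    (Set.toFinite s).measurableSet.nullMeasurableSet

theorem integral_exp_indicator_le {Ω : Type*} [MeasurableSpace Ω] [DiscreteMeasurableSpace Ω]
    (μ : Measure Ω) [IsProbabilityMeasure μ] (s : Set Ω) [DecidablePred (· ∈ s)] {q : ℝ}
    (hq : μ.real s ≤ q) :
    ∫ x, (if x ∈ s then Real.exp 1 else 1) ∂μ ≤ Real.exp (2 * q) := by
  have hs : MeasurableSet s := .of_discrete
  have h : (fun x => if x ∈ s then Real.exp 1 else 1) =
      fun x => 1 + s.indicator (fun _ => Real.exp 1 - 1) x := by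
    ext x
    by_cases hx : x ∈ s <;> simp [hx]
  rw [h, integral_add (integrable_const _) ((integrable_const _).indicator hs),
    integral_indicator_const _ hs]
  simp only [integral_const, probReal_univ, smul_eq_mul, mul_one]
  have h1 : 0 ≤ μ.real s := measureReal_nonneg
  have h2 := Real.add_one_le_exp (2 * q)
  -- The expectation is at most `1 + (e - 1) q`, and `e - 1 < 2`.
  have h3 := Real.exp_one_lt_d9
  nlinarith

/-- Chernoff bound for the number of samples that separate two vertices. -/
theorem sampleLaw_sepCount_le (D : Fin m → PMF (Clustering G)) (i : Fin m) (x y : Fin n) {q : ℝ}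
    (hq : (D i).toMeasure.real {P | P.center x ≠ P.center y} ≤ q) :
    (sampleLaw (g := g) D).real {ω | 4 * q * g ≤ sepCount (fun j => ω (i, j)) x y} ≤
      Real.exp (-(2 * (g * q))) := by
  classical
  -- The exponential of the count is a product over independent samples, with factor `1` for samples
  -- of other levels.
  let f : Fin m × Fin g → Clustering G → ℝ := fun q P =>
    if q.1 = i then (if P ∈ {P : Clustering G | P.center x ≠ P.center y} then Real.exp 1 else 1)
      else 1
  have hf : ∀ ω : Fin m × Fin g → Clustering G,
      ∏ q, f q (ω q) = Real.exp (sepCount (fun j => ω (i, j)) x y) := by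
    intro ω
    rw [Fintype.prod_prod_type, Finset.prod_eq_single i]
    · simp only [f, if_true, Set.mem_ofPred_eq]
      rw [Finset.prod_ite, Finset.prod_const_one, mul_one, Finset.prod_const, ← Real.exp_nat_mul,
        mul_one, sepCount]
    · intro b _ hb
      simp [f, hb]
    · simp
  have hint : ∫ ω, Real.exp (sepCount (fun j => ω (i, j)) x y) ∂(sampleLaw (g := g) D) ≤
      Real.exp (2 * (g * q)) := by
    simp_rw [← hf]
    rw [sampleLaw, integral_fintype_prod_eq_prod (𝕜 := ℝ) f, Fintype.prod_prod_type,
      Finset.prod_eq_single i]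
    · simp only [f, if_true]
      rw [Finset.prod_const, Finset.card_univ, Fintype.card_fin]
      refine (pow_le_pow_left₀ (integral_nonneg fun P => ?_)
        (integral_exp_indicator_le _ _ hq) g).trans ?_
      · dsimp only [Pi.zero_apply]
        split_ifs <;> positivity
      · rw [← Real.exp_nat_mul]
        apply le_of_eq
        ring_nf
    · intro b _ hb
      simp [f, hb]
    · simp
  have hmarkov := mul_meas_ge_le_integral_of_nonneg (μ := sampleLaw (g := g) D)
    (f := fun ω => Real.exp (sepCount (fun j => ω (i, j)) x y))
    (Filter.Eventually.of_forall fun ω => (Real.exp_pos _).le) .of_finite (Real.exp (4 * q * g))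
  -- The threshold is four times the bound `g q` on the mean and the moment bound is `exp (2 g q)`,
  -- so Markov's inequality leaves `exp (2 g q - 4 g q)`.
  simp only [Real.exp_le_exp] at hmarkov
  have := hmarkov.trans hint
  rw [← le_div_iff₀' (Real.exp_pos _), ← Real.exp_sub] at this
  exact this.trans (Real.exp_le_exp.2 (by linarith))

theorem sampleLaw_good_ge {ρ α δ T : ℝ} (hρ : 1 ≤ ρ) (hα : 0 ≤ α)
    (hT : T ≤ g * (α / ρ)) (D : Fin m → PMF (Clustering G))
    (hD : ∀ i : Fin m, IsLDD G w (ρ ^ ((i : ℕ) + 1)) α δ (D i)) :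
    1 - (m * g * δ + m * n * n * Real.exp (-(2 * T))) ≤ (sampleLaw (g := g) D).real
      {ω | (∀ (i : Fin m) (j : Fin g), (ω (i, j)).HasRadius w (ρ ^ ((i : ℕ) + 1))) ∧
        ∀ (i : Fin m) (x y : Fin n), (sepCount (fun j => ω (i, j)) x y : ℝ) ≤
          4 * (α * max (wdist G w x y) (ρ ^ (i : ℕ)) / ρ ^ ((i : ℕ) + 1)) * g} := by
  have hρ0 : 0 < ρ := by linarith
  set S := {ω : Fin m × Fin g → Clustering G | _}
  let A : Fin m × Fin g → Set (Fin m × Fin g → Clustering G) := fun q =>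
    {ω | ω q ∈ {P : Clustering G | P.HasRadius w (ρ ^ ((q.1 : ℕ) + 1))}ᶜ}
  let B : Fin m × Fin n × Fin n → Set (Fin m × Fin g → Clustering G) := fun q =>
    {ω | 4 * (α * max (wdist G w q.2.1 q.2.2) (ρ ^ (q.1 : ℕ)) / ρ ^ ((q.1 : ℕ) + 1)) * g ≤
      sepCount (fun j => ω (q.1, j)) q.2.1 q.2.2}
  have hA : ∀ q, (sampleLaw D).real (A q) ≤ δ := fun q => by
    rw [sampleLaw_eval, probReal_compl_eq_one_sub (Set.toFinite _).measurableSet]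
    linarith [(hD q.1).1]
  have hB : ∀ q, (sampleLaw D).real (B q) ≤ Real.exp (-(2 * T)) := fun q => by
    refine (sampleLaw_sepCount_le D q.1 q.2.1 q.2.2 (((hD q.1).2 _ _).trans ?_)).trans ?_
    · rw [← mul_div_assoc]
      gcongr
      exact le_max_left _ _
    · rw [Real.exp_le_exp, neg_le_neg_iff]
      -- The floor `ρ^i` is used here: it makes the tail bound the same for all pairs and levels.
      have : α / ρ ≤ α * max (wdist G w q.2.1 q.2.2) (ρ ^ (q.1 : ℕ)) / ρ ^ ((q.1 : ℕ) + 1) := by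
        calc α / ρ = α * ρ ^ (q.1 : ℕ) / ρ ^ ((q.1 : ℕ) + 1) := by rw [pow_succ]; field_simp
          _ ≤ _ := by gcongr; exact le_max_right _ _
      have := mul_le_mul_of_nonneg_left this (Nat.cast_nonneg (α := ℝ) g)
      linarith
  have hS : Sᶜ ⊆ (⋃ q, A q) ∪ ⋃ q, B q := by
    intro ω hω
    by_contra hcon
    simp only [Set.mem_union, Set.mem_iUnion, not_or, not_exists, A, B, Set.mem_ofPred_eq,
      Set.mem_compl_iff, not_not, not_le] at hcon
    exact hω ⟨fun i j => hcon.1 (i, j), fun i x y => (hcon.2 (i, x, y)).le⟩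
  have hle : (sampleLaw D).real Sᶜ ≤ m * g * δ + m * n * n * Real.exp (-(2 * T)) := by
    refine (measureReal_mono hS).trans ((measureReal_union_le _ _).trans (add_le_add ?_ ?_))
    · refine (measureReal_iUnion_fintype_le _).trans ((Finset.sum_le_sum fun q _ => hA q).trans ?_)
      simp
    · refine (measureReal_iUnion_fintype_le _).trans ((Finset.sum_le_sum fun q _ => hB q).trans ?_)
      simp [mul_assoc]
  rw [probReal_compl_eq_one_sub (Set.toFinite _).measurableSet] at hle
  linarith

end Sampling

/-! ### Asymptotics of the parameters. -/

section Parameters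

theorem log_log_three_pos : 0 < Real.log (Real.log 3) :=
  Real.log_pos ((Real.lt_log_iff_exp_lt (by norm_num)).2 (by
    have := Real.exp_one_lt_d9; linarith))

variable {n : ℕ}

theorem log_three_le_log (hn : 3 ≤ n) : Real.log 3 ≤ Real.log n :=
  Real.log_le_log (by norm_num) (by exact_mod_cast hn)

theorem one_lt_log (hn : 3 ≤ n) : 1 < Real.log n :=
  ((Real.lt_log_iff_exp_lt (by norm_num)).2 (by
    have := Real.exp_one_lt_d9; linarith)).trans_le (log_three_le_log hn)

theorem log_log_three_le (hn : 3 ≤ n) : Real.log (Real.log 3) ≤ Real.log (Real.log n) :=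
  Real.log_le_log (Real.log_pos (by norm_num)) (log_three_le_log hn)

theorem log_log_pos (hn : 3 ≤ n) : 0 < Real.log (Real.log n) :=
  Real.log_pos (one_lt_log hn)

/-- `(log n · log log n) ^ (1/4)`, the scale in which all parameters are polynomials. -/
noncomputable def scale (n : ℕ) : ℝ := (Real.log n * Real.log (Real.log n)) ^ (1 / 4 : ℝ)

theorem scale_pos (hn : 3 ≤ n) : 0 < scale n :=
  Real.rpow_pos_of_pos (mul_pos (by linarith [one_lt_log hn]) (log_log_pos hn)) _

theorem scale_three_le (hn : 3 ≤ n) : scale 3 ≤ scale n := by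
  have h3 := log_log_three_pos
  have := log_three_le_log hn
  have := log_log_three_le hn
  have := one_lt_log (n := 3) le_rfl
  unfold scale
  push_cast at *
  gcongr

theorem log_mul_log_log_nonneg (hn : 3 ≤ n) : 0 ≤ Real.log n * Real.log (Real.log n) :=
  (mul_pos (by linarith [one_lt_log hn]) (log_log_pos hn)).le

theorem scale_sq (hn : 3 ≤ n) : scale n ^ 2 = √(Real.log n * Real.log (Real.log n)) := by
  rw [scale, ← Real.rpow_natCast, ← Real.rpow_mul (log_mul_log_log_nonneg hn), Real.sqrt_eq_rpow]
  norm_num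

theorem scale_cube (hn : 3 ≤ n) :
    scale n ^ 3 = (Real.log n * Real.log (Real.log n)) ^ (3 / 4 : ℝ) := by
  rw [scale, ← Real.rpow_natCast, ← Real.rpow_mul (log_mul_log_log_nonneg hn)]
  norm_num

theorem quality_eq (c : ℝ) (hn : 3 ≤ n) : quality c n = Real.exp (c * scale n ^ 2) := by
  rw [quality, scale_sq hn]

theorem expThreeQuarters_eq {c : ℝ} (hc : 0 ≤ c) (hn : 3 ≤ n) :
    expThreeQuarters c n = Real.exp (c ^ (3 / 4 : ℝ) * scale n ^ 3) := by
  rw [expThreeQuarters, scale_cube hn, Real.mul_rpow hc (log_mul_log_log_nonneg hn)]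

theorem one_le_quality {c : ℝ} (hc : 0 ≤ c) (hn : 3 ≤ n) : 1 ≤ quality c n := by
  rw [quality_eq c hn]
  exact Real.one_le_exp (by positivity)

theorem one_le_expThreeQuarters {c : ℝ} (hc : 0 ≤ c) (hn : 3 ≤ n) : 1 ≤ expThreeQuarters c n := by
  rw [expThreeQuarters_eq hc hn]
  exact Real.one_le_exp (mul_nonneg (by positivity) (pow_nonneg (scale_pos hn).le 3))

/-- Since `log log n ≤ 3 (log n)^(1/3)`, the exponent of `ρ` is `O(log n)`. So `ρ` and the number of
samples are polynomial in `n`, and a union bound over all samples is affordable. -/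
theorem scale_cube_le (hn : 3 ≤ n) : scale n ^ 3 ≤ 3 ^ (3 / 4 : ℝ) * Real.log n := by
  have hL := one_lt_log hn
  have hL0 : 0 ≤ Real.log n := by linarith
  have h1 : Real.log (Real.log n) ≤ Real.log n ^ (1 / 3 : ℝ) / (1 / 3) :=
    Real.log_le_rpow_div hL0 (by norm_num)
  have h2 : Real.log n * Real.log (Real.log n) ≤ 3 * Real.log n ^ (4 / 3 : ℝ) := by
    have : Real.log n ^ (4 / 3 : ℝ) = Real.log n * Real.log n ^ (1 / 3 : ℝ) := by
      rw [show (4 / 3 : ℝ) = 1 + 1 / 3 by norm_num, Real.rpow_add (by linarith), Real.rpow_one]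
    rw [this]
    calc _ ≤ Real.log n * (Real.log n ^ (1 / 3 : ℝ) / (1 / 3)) := by gcongr
      _ = _ := by ring
  rw [scale_cube hn]
  refine (Real.rpow_le_rpow (log_mul_log_log_nonneg hn) h2 (by norm_num)).trans ?_
  rw [Real.mul_rpow (by norm_num) (by positivity), ← Real.rpow_mul hL0]
  norm_num

/-- Every multiple of `log n` is at most some `exp (c √(log n · log log n))`. -/
theorem exists_log_le_quality (a : ℝ) (ha : 0 < a) :
    ∃ c : ℝ, 0 < c ∧ ∀ n : ℕ, 3 ≤ n → a * Real.log n ≤ quality c n := by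
  have h3 := log_log_three_pos
  refine ⟨1 + a / Real.log (Real.log 3), by positivity, fun n hn => ?_⟩
  have hL := one_lt_log hn
  have hl := log_log_pos hn
  -- In the exponent, the coefficient `1` pays for the factor `log n`; the remaining coefficient
  -- pays for `a`, because the square root is at least `log log 3`.
  have hs : Real.log (Real.log n) ≤ √(Real.log n * Real.log (Real.log n)) := by
    apply Real.le_sqrt_of_sq_le
    rw [sq]
    have := Real.log_le_sub_one_of_pos (show 0 < Real.log n by linarith)
    exact mul_le_mul_of_nonneg_right (by linarith) hl.le
  have hs3 : Real.log (Real.log 3) ≤ √(Real.log n * Real.log (Real.log n)) :=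
    (log_log_three_le hn).trans hs
  rw [quality, add_mul, one_mul, Real.exp_add, mul_comm a]
  gcongr
  · rw [← Real.log_le_iff_le_exp (by linarith)]
    exact hs
  · calc a ≤ Real.exp a := by linarith [Real.add_one_le_exp a]
      _ ≤ _ := by
        rw [Real.exp_le_exp, div_mul_eq_mul_div, le_div_iff₀ h3]
        gcongr

theorem exists_numLevels_le_scale (c : ℝ) (hc : 0 < c) :
    ∃ b : ℝ, 0 < b ∧ ∀ n : ℕ, 3 ≤ n → (numLevels c n : ℝ) ≤ b * scale n := by
  have h3 := log_log_three_pos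
  have hs3 := scale_pos (n := 3) le_rfl
  refine ⟨(c / Real.log (Real.log 3)) ^ (1 / 4 : ℝ) + 1 / scale 3, by positivity, fun n hn => ?_⟩
  have hL := one_lt_log hn
  have hL0 : 0 ≤ Real.log n := by linarith
  refine (Nat.ceil_lt_add_one (by positivity)).le.trans ?_
  rw [add_mul]
  refine add_le_add ?_ ?_
  · rw [scale, ← Real.mul_rpow (by positivity) (log_mul_log_log_nonneg hn)]
    apply Real.rpow_le_rpow (by positivity) _ (by norm_num)
    rw [div_mul_eq_mul_div, le_div_iff₀ h3, mul_assoc]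
    have := log_log_three_le hn
    gcongr
  · rw [one_div_mul_eq_div, one_le_div hs3]
    exact scale_three_le hn

theorem numLevels_pos {c : ℝ} (hc : 0 < c) (hn : 3 ≤ n) : 0 < numLevels c n :=
  Nat.ceil_pos.2 (Real.rpow_pos_of_pos (mul_pos hc (by linarith [one_lt_log hn])) _)

theorem exp_mul_log (hn : 3 ≤ n) (a : ℝ) : Real.exp (a * Real.log n) = (n : ℝ) ^ a := by
  rw [Real.rpow_def_of_pos (by positivity), mul_comm]

theorem numLevels_le_rpow {c : ℝ} (hc : 0 < c) (hn : 3 ≤ n) :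
    (numLevels c n : ℝ) ≤ (n : ℝ) ^ (c + 1) := by
  have hL := one_lt_log hn
  have hx : 0 ≤ c * Real.log n := mul_nonneg hc.le (by linarith)
  rw [← exp_mul_log hn]
  have h1 : (c * Real.log n) ^ (1 / 4 : ℝ) ≤ c * Real.log n + 1 := by
    calc _ ≤ (c * Real.log n + 1) ^ (1 / 4 : ℝ) :=
          Real.rpow_le_rpow hx (by linarith) (by norm_num)
      _ ≤ (c * Real.log n + 1) ^ (1 : ℝ) :=
          Real.rpow_le_rpow_of_exponent_le (by linarith) (by norm_num)
      _ = _ := Real.rpow_one _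
  calc (numLevels c n : ℝ) ≤ (c * Real.log n) ^ (1 / 4 : ℝ) + 1 :=
        (Nat.ceil_lt_add_one (by positivity)).le
    _ ≤ (c + 1) * Real.log n + 1 := by linarith
    _ ≤ _ := Real.add_one_le_exp _

theorem expThreeQuarters_le_rpow {c : ℝ} (hc : 0 ≤ c) (hn : 3 ≤ n) :
    expThreeQuarters c n ≤ (n : ℝ) ^ (c ^ (3 / 4 : ℝ) * 3 ^ (3 / 4 : ℝ)) := by
  rw [expThreeQuarters_eq hc hn, ← exp_mul_log hn, mul_assoc]
  gcongr
  exact scale_cube_le hn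

theorem numSamples_le {c ρ α : ℝ} (hc : 0 ≤ c) (hρ : 1 ≤ ρ) (hα : 1 ≤ α) (hn : 3 ≤ n) :
    (numSamples c n ρ α : ℝ) ≤ (n : ℝ) ^ c * ρ := by
  have hL := one_lt_log hn
  have hx : 0 ≤ c * Real.log n := mul_nonneg hc (by linarith)
  calc (numSamples c n ρ α : ℝ) ≤ c * Real.log n * (ρ / α) + 1 :=
        (Nat.ceil_lt_add_one (by positivity)).le
    _ ≤ c * Real.log n * ρ + ρ := by
        gcongr
        exact div_le_self (by linarith) hα
    _ = (c * Real.log n + 1) * ρ := by ring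
    _ ≤ _ := by
        rw [← exp_mul_log hn]
        gcongr
        exact Real.add_one_le_exp _

theorem le_numSamples_mul {c ρ α : ℝ} (hρ : 0 < ρ) (hα : 0 < α) :
    c * Real.log n ≤ numSamples c n ρ α * (α / ρ) := by
  calc c * Real.log n = c * Real.log n * (ρ / α) * (α / ρ) := by field_simp
    _ ≤ _ := by
      gcongr
      exact Nat.le_ceil _

theorem numSamples_pos {c ρ α : ℝ} (hc : 0 < c) (hρ : 0 < ρ) (hα : 0 < α) (hn : 3 ≤ n) :
    0 < numSamples c n ρ α :=
  Nat.ceil_pos.2 (mul_pos (mul_pos hc (by linarith [one_lt_log hn])) (div_pos hρ hα))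

theorem exists_approximation_le (cα cρ ci : ℝ) (hα : 0 < cα) (hρ : 0 < cρ) (hi : 0 < ci) :
    ∃ A : ℝ, 0 < A ∧ ∀ n : ℕ, 3 ≤ n →
      2 * (8 * numLevels ci n * quality cα n) ^ numLevels ci n *
        (numLevels ci n * expThreeQuarters cρ n + 1) ≤ expThreeQuarters A n := by
  obtain ⟨b, hb, hbm⟩ := exists_numLevels_le_scale ci hi
  set s := scale 3
  have hs : 0 < s := scale_pos le_rfl
  -- The summands pay, in order, for the factor `2`, for `(8 m)^m ≤ exp (8 m^2)`, for `α^m`, for `m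
  -- ρ + 1 ≤ exp (2 m) ρ`, and for `ρ` itself. Lower powers of the scale are raised to the cube
  -- using its minimum `s`. The witness `c^(4/3)` undoes the power `3/4`.
  set c := 1 / s ^ 3 + 8 * b ^ 2 / s + b * cα + 2 * b / s ^ 2 + cρ ^ (3 / 4 : ℝ) with hc
  have hc0 : 0 < c := by positivity
  refine ⟨c ^ (4 / 3 : ℝ), by positivity, fun n hn => ?_⟩
  have hX := scale_pos hn
  have hsX : s ≤ scale n := scale_three_le hn
  have hm0 : (1 : ℝ) ≤ numLevels ci n := by exact_mod_cast numLevels_pos hi hn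
  have hmX := hbm n hn
  rw [expThreeQuarters_eq (c := c ^ (4 / 3 : ℝ)) (by positivity) hn, expThreeQuarters_eq hρ.le hn, quality_eq _ hn,
    ← Real.rpow_mul hc0.le, show (4 / 3 * (3 / 4) : ℝ) = 1 by norm_num, Real.rpow_one]
  set X := scale n
  set m := numLevels ci n
  have h1 : (2 : ℝ) ≤ Real.exp 1 := by linarith [Real.add_one_le_exp (1 : ℝ)]
  have h2 : (8 : ℝ) * m ≤ Real.exp (8 * m) := by linarith [Real.add_one_le_exp (8 * (m : ℝ))]
  have h3 : 1 ≤ Real.exp (cρ ^ (3 / 4 : ℝ) * X ^ 3) := Real.one_le_exp (by positivity)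
  have h4 : m * Real.exp (cρ ^ (3 / 4 : ℝ) * X ^ 3) + 1 ≤
      Real.exp (2 * m) * Real.exp (cρ ^ (3 / 4 : ℝ) * X ^ 3) := by
    have := Real.add_one_le_exp (2 * (m : ℝ))
    nlinarith
  calc _ ≤ Real.exp 1 * (Real.exp (8 * m) * Real.exp (cα * X ^ 2)) ^ m *
        (Real.exp (2 * m) * Real.exp (cρ ^ (3 / 4 : ℝ) * X ^ 3)) := by gcongr
    _ = Real.exp (1 + m * (8 * m + cα * X ^ 2) + 2 * m + cρ ^ (3 / 4 : ℝ) * X ^ 3) := by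
        rw [← Real.exp_add, ← Real.exp_nat_mul, ← Real.exp_add, ← Real.exp_add, ← Real.exp_add]
        ring_nf
    _ ≤ Real.exp (c * X ^ 3) := by
        rw [Real.exp_le_exp]
        have e1 : 1 ≤ 1 / s ^ 3 * X ^ 3 := by
          rw [one_div_mul_eq_div, one_le_div (by positivity)]
          gcongr
        have e2 : 8 * (m : ℝ) ^ 2 ≤ 8 * b ^ 2 / s * X ^ 3 := by
          rw [div_mul_eq_mul_div, le_div_iff₀ hs]
          calc 8 * (m : ℝ) ^ 2 * s ≤ 8 * (b * X) ^ 2 * X := by gcongr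
            _ = _ := by ring
        have e3 : m * (cα * X ^ 2) ≤ b * cα * X ^ 3 := by
          calc _ ≤ b * X * (cα * X ^ 2) := by gcongr
            _ = _ := by ring
        have e4 : 2 * (m : ℝ) ≤ 2 * b / s ^ 2 * X ^ 3 := by
          rw [div_mul_eq_mul_div, le_div_iff₀ (by positivity)]
          calc 2 * (m : ℝ) * s ^ 2 ≤ 2 * (b * X) * X ^ 2 := by gcongr
            _ = _ := by ring
        rw [hc]
        nlinarith

end Parameters

/-- The constants under which the algorithm succeeds with high probability. -/
theorem exists_constants_succeeds (C cα cρ ci : ℝ) (hcα : 0 < cα) (hcρ : 0 < cρ)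
    (hci : 0 < ci) :
    ∃ A : ℝ, 0 < A ∧
      ∀ C' : ℝ, 0 < C' →
        ∃ cg₀ : ℝ, 0 < cg₀ ∧ ∀ cg : ℝ, cg₀ ≤ cg →
          ∃ K₀ : ℝ, 0 < K₀ ∧ ∀ K : ℝ, K₀ ≤ K →
            ∀ n : ℕ, 3 ≤ n →
            ∀ (α ρ : ℝ) (m g : ℕ),
              α = quality cα n →
              ρ = expThreeQuarters cρ n →
              m = numLevels ci n →
              g = numSamples cg n ρ α →
              (n : ℝ) ^ (C + 1) ≤ ρ ^ m →
            ∀ (G : SimpleGraph (Fin n)) (w : Sym2 (Fin n) → ℝ),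
              G.Connected →
              (∀ e ∈ G.edgeSet, 1 ≤ w e ∧ w e ≤ (n : ℝ) ^ C) →
            ∀ D : Fin m → PMF (Clustering G),
              (∀ i : Fin m, IsLDD G w (ρ ^ ((i : ℕ) + 1)) α ((n : ℝ) ^ (-K)) (D i)) →
              1 - (n : ℝ) ^ (-C') ≤ (sampleLaw (g := g) D).real
                {ω | Succeeds G w ρ (expThreeQuarters A n) ω} := by
  obtain ⟨A, hA, hAle⟩ := exists_approximation_le cα cρ ci hcα hcρ hci
  -- With `m ≤ n^(ci + 1)`, the union bound over levels and pairs needs `ci + 3 - 2 cg ≤ -C' - 1`.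
  refine ⟨A, hA, fun C' hC' => ⟨ci + 4 + C', by positivity, fun cg hcg => ?_⟩⟩
  have hcg0 : 0 < cg := by linarith
  -- This makes `m g n^(-K) ≤ n^(-C' - 1)`. Each failure term is then at most half of `n^(-C')`.
  refine ⟨ci + 2 + cg + cρ ^ (3 / 4 : ℝ) * 3 ^ (3 / 4 : ℝ) + C', by positivity, ?_⟩
  rintro K hK n hn α ρ m g hα hρ hm hg hρm G w hG hw D hD
  have hn3 : (3 : ℝ) ≤ n := by exact_mod_cast hn
  have hn0 : (0 : ℝ) < n := by linarith
  have hn1 : (1 : ℝ) ≤ n := by linarith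
  have hα1 : 1 ≤ α := hα ▸ one_le_quality hcα.le hn
  have hρ1 : 1 ≤ ρ := hρ ▸ one_le_expThreeQuarters hcρ.le hn
  have hgpos : 0 < g := hg ▸ numSamples_pos hcg0 (by linarith) (by linarith) hn
  have hmpos : 0 < m := hm ▸ numLevels_pos hci hn
  have hT : cg * Real.log n ≤ g * (α / ρ) := hg ▸ le_numSamples_mul (by linarith) (by linarith)
  have hbm : n * (n : ℝ) ^ C ≤ ρ ^ m := by
    rwa [Real.rpow_add hn0, Real.rpow_one, mul_comm] at hρm
  have ha : 2 * (8 * m * α) ^ m * (m * ρ + 1) ≤ expThreeQuarters A n := by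
    rw [hα, hρ, hm]
    exact hAle n hn
  have hgood := sampleLaw_good_ge (w := w) (g := g) hρ1 (by linarith) hT D hD
  have hmn : (m : ℝ) ≤ (n : ℝ) ^ (ci + 1) := hm ▸ numLevels_le_rpow hci hn
  have hgn : (g : ℝ) ≤ (n : ℝ) ^ cg * (n : ℝ) ^ (cρ ^ (3 / 4 : ℝ) * 3 ^ (3 / 4 : ℝ)) := by
    rw [hg]
    refine (numSamples_le hcg0.le hρ1 hα1 hn).trans ?_
    rw [hρ]
    gcongr
    exact expThreeQuarters_le_rpow hcρ.le hn
  have hhalf : (n : ℝ) ^ (-C' - 1) ≤ (n : ℝ) ^ (-C') / 2 := by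
    rw [Real.rpow_sub hn0, Real.rpow_one]
    gcongr
    linarith
  have hb1 : m * g * (n : ℝ) ^ (-K) ≤ (n : ℝ) ^ (-C' - 1) := by
    calc m * g * (n : ℝ) ^ (-K) ≤ (n : ℝ) ^ (ci + 1) *
          ((n : ℝ) ^ cg * (n : ℝ) ^ (cρ ^ (3 / 4 : ℝ) * 3 ^ (3 / 4 : ℝ))) * (n : ℝ) ^ (-K) := by
          gcongr
      _ = (n : ℝ) ^ (ci + 1 + (cg + cρ ^ (3 / 4 : ℝ) * 3 ^ (3 / 4 : ℝ)) + -K) := by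
          rw [Real.rpow_add hn0 _ (-K), Real.rpow_add hn0 _ (cg + _), Real.rpow_add hn0 cg]
      _ ≤ _ := Real.rpow_le_rpow_of_exponent_le hn1 (by linarith)
  have hb2 : m * n * n * Real.exp (-(2 * (cg * Real.log n))) ≤ (n : ℝ) ^ (-C' - 1) := by
    calc m * n * n * Real.exp (-(2 * (cg * Real.log n)))
        ≤ (n : ℝ) ^ (ci + 1) * n * n * (n : ℝ) ^ (-(2 * cg)) := by
          rw [← exp_mul_log hn (-(2 * cg)), show -(2 * cg) * Real.log n =
            -(2 * (cg * Real.log n)) by ring]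
          gcongr
      _ = (n : ℝ) ^ (ci + 1 + 1 + 1 + -(2 * cg)) := by
          rw [Real.rpow_add hn0 _ (-(2 * cg)), Real.rpow_add hn0 (ci + 1 + 1),
            Real.rpow_add hn0 (ci + 1),
            Real.rpow_one]
      _ ≤ _ := Real.rpow_le_rpow_of_exponent_le hn1 (by linarith)
  refine le_trans (by linarith) (hgood.trans (measureReal_mono ?_))
  rintro ω ⟨hrad, hsep⟩
  exact succeeds_of_good hG hw (by positivity) hgpos hmpos hρ1 hα1 hbm ha hrad hsep

/-! ### Random ball carving. -/

section Carving

open scoped ENNReal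

variable {n : ℕ} {G : SimpleGraph (Fin n)} {w : Sym2 (Fin n) → ℝ}

theorem walkLength_dropUntil_le (hw : ∀ e ∈ G.edgeSet, 0 ≤ w e) {u v x : Fin n} (p : G.Walk u v)
    (hx : x ∈ p.support) : walkLength w (p.dropUntil x hx) ≤ walkLength w p := by
  rw [← congrArg (walkLength w) (p.take_spec hx), walkLength_append]
  linarith [walkLength_nonneg hw (p.takeUntil x hx)]

/-- The clustering given by a map to centers along walks that stay in the fibers. -/
def Clustering.ofWalks (c : Fin n → Fin n)
    (h : ∀ v, ∃ p : G.Walk v (c v), ∀ u ∈ p.support, c u = c v) : Clustering G where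
  center := c
  center_center v := by
    obtain ⟨p, hp⟩ := h v
    exact hp _ p.end_mem_support
  connected v := by
    have hc : c (c v) = c v := by
      obtain ⟨p, hp⟩ := h v
      exact hp _ p.end_mem_support
    refine SimpleGraph.induce_connected_of_patches (c v) hc fun {u} hu => ?_
    have hu' : c u = c v := hu
    obtain ⟨p, hp⟩ := h u
    refine ⟨{x | x ∈ p.support}, fun x hx => (hp x hx).trans hu', ?_, p.start_mem_support, ?_⟩
    · rw [← hu']
      exact p.end_mem_support
    · exact p.connected_induce_support.preconnected _ _

/-- `c` sends each vertex of `U` to a center along a walk of length at most `r` that stays in `U` and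
in the part of that vertex. -/
def IsPartialClustering (G : SimpleGraph (Fin n)) (w : Sym2 (Fin n) → ℝ) (r : ℝ)
    (U : Finset (Fin n)) (c : Fin n → Fin n) : Prop :=
  ∀ v ∈ U, ∃ p : G.Walk v (c v), (∀ u ∈ p.support, u ∈ U ∧ c u = c v) ∧ walkLength w p ≤ r

/-- The vertices with a walk of length at most `t` to `v` inside `U`. -/
noncomputable def ballIn (G : SimpleGraph (Fin n)) (w : Sym2 (Fin n) → ℝ) (U : Finset (Fin n))
    (v : Fin n) (t : ℝ) : Finset (Fin n) := by
  classical
  exact U.filter fun u => ∃ p : G.Walk u v, (∀ x ∈ p.support, x ∈ U) ∧ walkLength w p ≤ t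

theorem mem_ballIn {U : Finset (Fin n)} {v u : Fin n} {t : ℝ} :
    u ∈ ballIn G w U v t ↔
      ∃ p : G.Walk u v, (∀ x ∈ p.support, x ∈ U) ∧ walkLength w p ≤ t := by
  simp only [ballIn, Finset.mem_filter, and_iff_right_iff_imp]
  rintro ⟨p, hp, -⟩
  exact hp u p.start_mem_support

theorem ballIn_mono {U : Finset (Fin n)} {v : Fin n} {t t' : ℝ} (h : t ≤ t') :
    ballIn G w U v t ⊆ ballIn G w U v t' := fun u hu => by
  rw [mem_ballIn] at hu ⊢
  obtain ⟨p, hp, hl⟩ := hu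
  exact ⟨p, hp, hl.trans h⟩

theorem mem_ballIn_of_adj {U : Finset (Fin n)} {v x y : Fin n} {t : ℝ} (h : G.Adj x y)
    (hx : x ∈ U) (hy : y ∈ ballIn G w U v t) : x ∈ ballIn G w U v (w s(x, y) + t) := by
  rw [mem_ballIn] at hy ⊢
  obtain ⟨p, hp, hl⟩ := hy
  refine ⟨.cons h p, ?_, by rw [walkLength_cons]; linarith⟩
  intro z hz
  rw [SimpleGraph.Walk.support_cons, List.mem_cons] at hz
  rcases hz with rfl | hz
  · exact hx
  · exact hp z hz

/-- A walk witnessing membership in the ball stays in the ball, since its tails are witnesses for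
its later vertices. Walks of the remaining clustering avoid the ball, so their labels do not change.
-/
theorem isPartialClustering_carve (hw : ∀ e ∈ G.edgeSet, 0 ≤ w e) {U : Finset (Fin n)} {v : Fin n}
    {r t : ℝ} (ht : t ≤ r) {c : Fin n → Fin n}
    (hc : IsPartialClustering G w r (U \ ballIn G w U v t) c) :
    IsPartialClustering G w r U fun u => if u ∈ ballIn G w U v t then v else c u := by
  intro u hu
  by_cases hub : u ∈ ballIn G w U v t
  · obtain ⟨p, hp, hl⟩ := mem_ballIn.1 hub
    dsimp only
    rw [if_pos hub]
    refine ⟨p, fun x hx => ⟨hp x hx, if_pos (mem_ballIn.2 ⟨p.dropUntil x hx, ?_, ?_⟩)⟩,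
      hl.trans ht⟩
    · exact fun z hz => hp z (p.support_dropUntil_subset_support hx hz)
    · exact (walkLength_dropUntil_le hw p hx).trans hl
  · obtain ⟨p, hp, hl⟩ := hc u (Finset.mem_sdiff.2 ⟨hu, hub⟩)
    dsimp only
    rw [if_neg hub]
    refine ⟨p, fun x hx => ?_, hl⟩
    obtain ⟨hx1, hx2⟩ := hp x hx
    rw [Finset.mem_sdiff] at hx1
    exact ⟨hx1.1, by rw [if_neg hx1.2, hx2]⟩

theorem toOuterMeasure_Ico_le {γ : PMF ℕ} {β ε : ℝ≥0∞} {a : ℕ}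
    (hγ : ∀ k, a ≤ k → γ k ≤ β * γ.toOuterMeasure {j | a ≤ j} + ε) (s : ℕ) :
    γ.toOuterMeasure {k | a ≤ k ∧ k < a + s} ≤ s * (β * γ.toOuterMeasure {j | a ≤ j} + ε) := by
  have h : {k | a ≤ k ∧ k < a + s} = (↑(Finset.Ico a (a + s)) : Set ℕ) := by
    ext k; simp
  rw [h, PMF.toOuterMeasure_apply_finset]
  refine (Finset.sum_le_card_nsmul _ _ _ fun k hk => hγ k (Finset.mem_Ico.1 hk).1).trans ?_
  rw [Nat.card_Ico, Nat.add_sub_cancel_left, nsmul_eq_mul]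

/-- Ball carving: if the law `γ` of the radii (in steps of size `h`) satisfies a memoryless bound up
to an error `ε`, there is a random partition of `U` that cuts edges with small probability. -/
theorem exists_carving (hw : ∀ e ∈ G.edgeSet, 0 ≤ w e) {r h : ℝ} (hh : 0 < h) (γ : PMF ℕ)
    {β ε : ℝ≥0∞} (hr : ∀ k ∈ γ.support, k * h ≤ r)
    (hγ : ∀ a k, a ≤ k → γ k ≤ β * γ.toOuterMeasure {j | a ≤ j} + ε) (U : Finset (Fin n)) :
    ∃ D : PMF (Fin n → Fin n), (∀ c ∈ D.support, IsPartialClustering G w r U c) ∧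
      ∀ x ∈ U, ∀ y ∈ U, G.Adj x y →
        D.toOuterMeasure {c | c x ≠ c y} ≤ ⌈w s(x, y) / h⌉₊ * (β + U.card * ε) := by
  induction U using Finset.strongInduction with
  | H U ih =>
  rcases U.eq_empty_or_nonempty with rfl | ⟨v, hv⟩
  · exact ⟨PMF.pure id, fun c _ v hv => by simp at hv, fun x hx => by simp at hx⟩
  let B : ℕ → Finset (Fin n) := fun k => ballIn G w U v (k * h)
  have hvB : ∀ k, v ∈ B k := fun k =>
    mem_ballIn.2 ⟨.nil, by simpa using hv, by rw [walkLength_nil]; positivity⟩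
  have hBmono : ∀ {k l : ℕ}, k ≤ l → B k ⊆ B l := fun hkl => ballIn_mono (by gcongr)
  have hss : ∀ k, U \ B k ⊂ U := fun k =>
    Finset.ssubset_iff_subset_ne.2 ⟨Finset.sdiff_subset, fun he => by
      have := he ▸ hv
      exact (Finset.mem_sdiff.1 this).2 (hvB k)⟩
  choose D hDgood hDsep using fun k => ih (U \ B k) (hss k)
  refine ⟨γ.bind fun k => (D k).map fun c u => if u ∈ B k then v else c u, ?_, ?_⟩
  · intro c hc
    obtain ⟨k, hk, hc⟩ := (PMF.mem_support_bind_iff _ _ _).1 hc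
    obtain ⟨c', hc', rfl⟩ := (PMF.mem_support_map_iff _ _ _).1 hc
    exact isPartialClustering_carve hw (hr k hk) (hDgood k c' hc')
  intro x hx y hy hxy
  -- The number of radius steps in which a ball that contains one endpoint is sure to swallow the
  -- other.
  set s := ⌈w s(x, y) / h⌉₊
  have hs : w s(x, y) ≤ s * h := (div_le_iff₀ hh).1 (Nat.le_ceil _)
  rw [PMF.toOuterMeasure_bind_apply]
  simp only [PMF.toOuterMeasure_map_apply]
  set P : ℕ → ℝ≥0∞ := fun k => (D k).toOuterMeasure
    ((fun c u => if u ∈ B k then v else c u) ⁻¹' {c : Fin n → Fin n | c x ≠ c y})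
  obtain ⟨N, hN⟩ : ∃ N, U.card = N + 1 := Nat.exists_eq_succ_of_ne_zero (Finset.card_ne_zero_of_mem hv)
  have hP1 : ∀ k, P k ≤ 1 := fun k => by
    rw [← ((D k).toOuterMeasure_apply_eq_one_iff Set.univ).2 (Set.subset_univ _)]
    exact measure_mono (Set.subset_univ _)
  have hPlt : ∀ k, x ∉ B k → y ∉ B k → P k ≤ s * (β + N * ε) := by
    intro k hxk hyk
    simp only [P, Set.preimage_ofPred_eq, hxk, hyk, if_false]
    refine (hDsep k x (Finset.mem_sdiff.2 ⟨hx, hxk⟩) y (Finset.mem_sdiff.2 ⟨hy, hyk⟩) hxy).trans ?_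
    have : (U \ B k).card ≤ N := by
      have := Finset.card_lt_card (hss k)
      omega
    gcongr
  have hPge : ∀ k, x ∈ B k → y ∈ B k → P k = 0 := by
    intro k hxk hyk
    simp [P, hxk, hyk]
  have hQ : (s : ℝ≥0∞) * (β + N * ε) ≤ s * (β + U.card * ε) := by
    rw [hN]
    gcongr
    simp
  by_cases hex : ∃ k, x ∈ B k ∨ y ∈ B k
  · classical
    -- The first radius index at which the ball reaches an endpoint. The present ball can cut the
    -- edge only for indices in `[a, a + s)`; below `a` the edge survives into the recursion, and
    -- from `a + s` on it lies inside the ball.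
    let a := Nat.find hex
    have ha := Nat.find_spec hex
    have hlt : ∀ k < a, x ∉ B k ∧ y ∉ B k := fun k hk => not_or.1 (Nat.find_min hex hk)
    have hge : ∀ k, a + s ≤ k → x ∈ B k ∧ y ∈ B k := by
      intro k hk
      have hcast : s * h + a * h = ((a + s : ℕ) : ℝ) * h := by push_cast; ring
      rcases ha with ha | ha
      · refine ⟨hBmono (by omega) ha, hBmono hk ?_⟩
        refine ballIn_mono (t := w s(y, x) + a * h) ?_ (mem_ballIn_of_adj hxy.symm hy ha)
        rw [Sym2.eq_swap]
        linarith
      · refine ⟨hBmono hk ?_, hBmono (by omega) ha⟩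
        refine ballIn_mono (t := w s(x, y) + a * h) ?_ (mem_ballIn_of_adj hxy hx ha)
        linarith
    have hbound : ∀ k, γ k * P k ≤ {k | a ≤ k ∧ k < a + s}.indicator γ k +
        {k | k < a}.indicator γ k * (s * (β + N * ε)) := by
      intro k
      rcases lt_or_ge k a with hk | hk
      · rw [Set.indicator_of_notMem (by simp [hk]), zero_add, Set.indicator_of_mem (by simpa using hk)]
        gcongr
        exact hPlt k (hlt k hk).1 (hlt k hk).2
      · rcases lt_or_ge k (a + s) with hk' | hk'
        · rw [Set.indicator_of_mem (by simp [hk, hk'])]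
          exact le_add_right (mul_le_of_le_one_right' (hP1 k))
        · rw [hPge k (hge k hk').1 (hge k hk').2, mul_zero]
          exact zero_le
    have htot : γ.toOuterMeasure {j | a ≤ j} + γ.toOuterMeasure {k | k < a} = 1 := by
      rw [PMF.toOuterMeasure_apply, PMF.toOuterMeasure_apply, ← ENNReal.tsum_add, ← γ.tsum_coe]
      congr 1
      ext k
      rcases lt_or_ge k a with hk | hk <;> simp [Set.indicator, hk, not_le.2, not_lt.2]
    have hle1 : γ.toOuterMeasure {k | k < a} ≤ 1 := htot ▸ le_add_self
    -- Memorylessness charges the cut to the event that the index is at least `a`, and the recursion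
    -- is charged to the complement, so the coefficients of `β` add up to one. Each carving adds one
    -- error `ε`, and the recursion has at most `N = |U| - 1` vertices.
    calc ∑' k, γ k * P k ≤ γ.toOuterMeasure {k | a ≤ k ∧ k < a + s} +
          γ.toOuterMeasure {k | k < a} * (s * (β + N * ε)) := by
          rw [PMF.toOuterMeasure_apply, PMF.toOuterMeasure_apply, ← ENNReal.tsum_mul_right,
            ← ENNReal.tsum_add]
          exact ENNReal.tsum_le_tsum hbound
      _ ≤ s * (β * γ.toOuterMeasure {j | a ≤ j} + ε) +
          γ.toOuterMeasure {k | k < a} * (s * (β + N * ε)) := by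
          gcongr
          exact toOuterMeasure_Ico_le (hγ a) s
      _ = s * (β * (γ.toOuterMeasure {j | a ≤ j} + γ.toOuterMeasure {k | k < a}) +
            (ε + γ.toOuterMeasure {k | k < a} * (N * ε))) := by ring
      _ ≤ s * (β * 1 + (ε + 1 * (N * ε))) := by
          rw [htot]
          gcongr
      _ = s * (β + U.card * ε) := by
          rw [hN]; push_cast; ring
  · push Not at hex
    calc ∑' k, γ k * P k ≤ ∑' k, γ k * (s * (β + N * ε)) :=
          ENNReal.tsum_le_tsum fun k => by
            gcongr
            exact hPlt k (hex k).1 (hex k).2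
      _ = s * (β + N * ε) := by rw [ENNReal.tsum_mul_right, γ.tsum_coe, one_mul]
      _ ≤ _ := hQ

end Carving

/-! ### Low-diameter decompositions of logarithmic quality. -/

section LowDiameter

open scoped ENNReal

variable {n : ℕ} {G : SimpleGraph (Fin n)} {w : Sym2 (Fin n) → ℝ}

/-- The truncated geometric distribution on `{0, …, N - 1}`. -/
theorem exists_truncatedGeometric {q : ℝ} (hq0 : 0 ≤ q) (hq1 : q < 1) {N : ℕ} (hN : 0 < N) :
    ∃ γ : PMF ℕ, (∀ k ∈ γ.support, k < N) ∧ ∀ a k, a ≤ k →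
      γ k ≤ ENNReal.ofReal (1 - q) * γ.toOuterMeasure {j | a ≤ j} +
        ENNReal.ofReal (q ^ N * (1 - q) / (1 - q ^ N)) := by
  have hqN : q ^ N < 1 := pow_lt_one₀ hq0 hq1 hN.ne'
  have hq1' : 0 < 1 - q := by linarith
  have hqN' : 0 < 1 - q ^ N := by linarith
  let f : ℕ → ℝ≥0∞ := fun k =>
    if k < N then ENNReal.ofReal (q ^ k * ((1 - q) / (1 - q ^ N))) else 0
  have hsum : ∀ a ≤ N, ∑ k ∈ Finset.Ico a N, f k =
      ENNReal.ofReal ((q ^ a - q ^ N) / (1 - q ^ N)) := by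
    intro a ha
    rw [Finset.sum_congr rfl fun k hk => if_pos (Finset.mem_Ico.1 hk).2,
      ← ENNReal.ofReal_sum_of_nonneg fun k _ => by positivity, ← Finset.sum_mul,
      geom_sum_Ico hq1.ne ha]
    congr 1
    have : q - 1 ≠ 0 := by linarith
    field_simp
    ring
  have hf1 : ∑ k ∈ Finset.Ico 0 N, f k = 1 := by
    rw [hsum 0 (Nat.zero_le _), pow_zero, div_self hqN'.ne', ENNReal.ofReal_one]
  have hf0 : ∀ k ∉ Finset.Ico 0 N, f k = 0 := fun k hk => if_neg fun h => hk (by simpa using h)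
  refine ⟨PMF.ofFinset f (Finset.Ico 0 N) hf1 hf0, ?_, ?_⟩
  · intro k hk
    by_contra h
    exact hk (if_neg h)
  · intro a k hak
    rw [PMF.ofFinset_apply]
    by_cases hk : k < N
    · have ha : a ≤ N := by omega
      have h1 : ENNReal.ofReal ((q ^ a - q ^ N) / (1 - q ^ N)) ≤
          (PMF.ofFinset f (Finset.Ico 0 N) hf1 hf0).toOuterMeasure {j | a ≤ j} := by
        rw [← hsum a ha]
        calc ∑ j ∈ Finset.Ico a N, f j =
              (PMF.ofFinset f (Finset.Ico 0 N) hf1 hf0).toOuterMeasure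
                (↑(Finset.Ico a N) : Set ℕ) := by
              rw [PMF.toOuterMeasure_apply_finset]; rfl
          _ ≤ _ := measure_mono fun j hj => (Finset.mem_Ico.1 (Finset.mem_coe.1 hj)).1
      -- The tail from `a` is `(q^a - q^N) / (1 - q^N)`. At `k = a` the bound is an equality, with
      -- the error term restoring the missing `q^N`.
      refine le_trans ?_ (add_le_add_left (mul_le_mul_right h1 _) _)
      have h2 : 0 ≤ q ^ a - q ^ N := sub_nonneg.2 (pow_le_pow_of_le_one hq0 hq1.le ha)
      rw [← ENNReal.ofReal_mul hq1'.le, ← ENNReal.ofReal_add (by positivity) (by positivity),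
        show f k = _ from if_pos hk]
      apply ENNReal.ofReal_le_ofReal
      have h3 : q ^ k ≤ q ^ a := pow_le_pow_of_le_one hq0 hq1.le hak
      calc q ^ k * ((1 - q) / (1 - q ^ N)) ≤ q ^ a * ((1 - q) / (1 - q ^ N)) := by gcongr
        _ = _ := by field_simp; ring
    · rw [show f k = 0 from if_neg hk]
      exact zero_le

/-- It suffices to bound the probability that an edge is cut. -/
theorem isLDD_of_edges (hG : G.Connected) {r a : ℝ} (hr : 0 < r) (ha : 0 < a)
    (D : PMF (Clustering G)) (hD : ∀ P ∈ D.support, P.HasRadius w r)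
    (hcut : ∀ x y, G.Adj x y →
      D.toMeasure.real {P | P.center x ≠ P.center y} ≤ a * (w s(x, y) / r)) :
    IsLDD G w r a 0 D := by
  refine ⟨?_, fun x y => ?_⟩
  · have : D.toMeasure {P | P.HasRadius w r} = 1 :=
      (D.toMeasure_apply_eq_one_iff (Set.toFinite _).measurableSet).2 hD
    simp [measureReal_def, this]
  · have hwalk : ∀ {x y : Fin n} (p : G.Walk x y),
        D.toMeasure.real {P | P.center x ≠ P.center y} ≤ a * (walkLength w p / r) := by
      intro x y p
      induction p with
      | nil => simp [walkLength]
      | @cons u v z h p ih =>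
        have hsub : {P : Clustering G | P.center u ≠ P.center z} ⊆
            {P | P.center u ≠ P.center v} ∪ {P | P.center v ≠ P.center z} := by
          intro P hP
          by_contra hcon
          simp only [Set.mem_union, Set.mem_ofPred_eq, not_or, not_not] at hcon
          exact hP (hcon.1.trans hcon.2)
        rw [walkLength_cons, add_div, mul_add]
        exact (measureReal_mono hsub).trans
          ((measureReal_union_le _ _).trans (add_le_add (hcut _ _ h) ih))
    have : Nonempty (G.Walk x y) := hG.preconnected x y
    have hle : D.toMeasure.real {P | P.center x ≠ P.center y} * r / a ≤ wdist G w x y := by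
      apply le_ciInf
      intro p
      rw [div_le_iff₀ ha, ← le_div_iff₀ hr]
      exact (hwalk p).trans (by rw [mul_div_assoc', mul_comm])
    rw [div_le_iff₀ ha, ← le_div_iff₀ hr] at hle
    exact hle.trans (by rw [mul_div_assoc', mul_comm])

/-- A random partial clustering of all vertices is a random clustering. -/
theorem exists_clustering_law {r : ℝ} (D : PMF (Fin n → Fin n))
    (hD : ∀ c ∈ D.support, IsPartialClustering G w r Finset.univ c) :
    ∃ D' : PMF (Clustering G), (∀ P ∈ D'.support, P.HasRadius w r) ∧
      ∀ x y, D'.toMeasure {P | P.center x ≠ P.center y} ≤ D.toOuterMeasure {c | c x ≠ c y} := by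
  classical
  have hid : ∀ v : Fin n, ∃ p : G.Walk v (id v), ∀ u ∈ p.support, id u = id v :=
    fun v => ⟨.nil, by simp⟩
  -- The singleton clustering is a default value, taken only outside the support of `D`.
  let F : (Fin n → Fin n) → Clustering G := fun c =>
    if h : ∀ v, ∃ p : G.Walk v (c v), ∀ u ∈ p.support, c u = c v then .ofWalks c h
      else .ofWalks id hid
  have hF : ∀ c ∈ D.support, (F c).center = c := by
    intro c hc
    have h : ∀ v, ∃ p : G.Walk v (c v), ∀ u ∈ p.support, c u = c v := fun v => by
      obtain ⟨p, hp, -⟩ := hD c hc v (Finset.mem_univ _)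
      exact ⟨p, fun u hu => (hp u hu).2⟩
    simp only [F, dif_pos h]
    rfl
  refine ⟨D.map F, fun P hP v => ?_, fun x y => ?_⟩
  · obtain ⟨c, hc, rfl⟩ := (PMF.mem_support_map_iff _ _ _).1 hP
    obtain ⟨p, hp, hl⟩ := hD c hc v (Finset.mem_univ _)
    rw [hF c hc]
    exact ⟨p, fun u hu => (hp u hu).2, hl⟩
  · rw [PMF.toMeasure_apply_eq_toOuterMeasure_apply _ (Set.toFinite _).measurableSet,
      PMF.toOuterMeasure_map_apply]
    apply PMF.toOuterMeasure_mono
    rintro c ⟨h, hc⟩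
    simpa [hF c hc] using h

/-- Low-diameter decompositions of quality `O(log n)`. -/
theorem exists_isLDD_log (hn : 3 ≤ n) (hG : G.Connected) (hw : ∀ e ∈ G.edgeSet, 1 ≤ w e) {r : ℝ}
    (hr : 1 ≤ r) : ∃ D : PMF (Clustering G), IsLDD G w r (8 * Real.log n) 0 D := by
  have hL := one_lt_log hn
  have hr0 : 0 < r := by linarith
  have hw0 : ∀ e ∈ G.edgeSet, 0 ≤ w e := fun e he => zero_le_one.trans (hw e he)
  set N := ⌈r⌉₊
  have hrN : r ≤ N := Nat.le_ceil r
  have hN : 0 < N := Nat.ceil_pos.2 hr0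
  have hN0 : (0 : ℝ) < N := by exact_mod_cast hN
  -- For small radius the required bound is at least `1` on every edge, so singletons suffice.
  -- Otherwise `2 log n / N` is a valid geometric parameter.
  rcases le_or_gt (N : ℝ) (2 * Real.log n) with hsmall | hlarge
  · obtain ⟨D, hDr, -⟩ := exists_clustering_law (G := G) (w := w) (r := r) (PMF.pure id)
      (fun c hc v _ => by
        rw [PMF.mem_support_pure_iff] at hc
        subst hc
        exact ⟨.nil, by simp, by rw [walkLength_nil]; exact hr0.le⟩)
    refine ⟨D, isLDD_of_edges hG hr0 (by linarith) D hDr fun x y hxy => measureReal_le_one.trans ?_⟩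
    have := hw s(x, y) hxy
    rw [← mul_div_assoc, one_le_div hr0]
    nlinarith
  · set β := 2 * Real.log n / N with hβ
    have hβ0 : 0 < β := by positivity
    have hβ1 : β < 1 := (div_lt_one hN0).2 hlarge
    obtain ⟨γ, hγN, hγ⟩ := exists_truncatedGeometric (q := 1 - β) (by linarith) (by linarith) hN
    rw [sub_sub_cancel] at hγ
    obtain ⟨D₀, hD₀, hcut⟩ := exists_carving (G := G) hw0 (r := r) (h := r / N) (by positivity) γ
      (fun k hk => by
        have : (k : ℝ) ≤ N := by exact_mod_cast (hγN k hk).le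
        rw [mul_div_assoc', div_le_iff₀ hN0, mul_comm]
        gcongr) hγ Finset.univ
    obtain ⟨D, hDr, hDcut⟩ := exists_clustering_law D₀ hD₀
    refine ⟨D, isLDD_of_edges hG hr0 (by linarith) D hDr fun x y hxy => ?_⟩
    have hW : 1 ≤ w s(x, y) := hw _ hxy
    have hn3 : (3 : ℝ) ≤ n := by exact_mod_cast hn
    have hqN : (1 - β) ^ N ≤ 1 / (n : ℝ) ^ 2 := by
      calc (1 - β) ^ N ≤ Real.exp (-β) ^ N := by
            gcongr
            linarith [Real.add_one_le_exp (-β)]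
        _ = Real.exp (-(2 * Real.log n)) := by
            rw [← Real.exp_nat_mul, hβ]
            congr 1
            field_simp
        _ = 1 / (n : ℝ) ^ 2 := by
            rw [Real.exp_neg, two_mul, Real.exp_add, Real.exp_log (by linarith), one_div, sq]
    -- The factor `2` in `β` gives `(1 - β)^N ≤ n^(-2)`, so the truncation errors of all `n`
    -- carvings together cost at most another `β`.
    have hε : n * ((1 - β) ^ N * β / (1 - (1 - β) ^ N)) ≤ β := by
      have h1 : (1 : ℝ) / n ^ 2 < 1 := by
        rw [div_lt_one (by positivity)]
        nlinarith
      rw [mul_div_assoc', div_le_iff₀ (by linarith)]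
      have h2 : (1 - β) ^ N * (n + 1) ≤ 1 := by
        calc (1 - β) ^ N * (n + 1) ≤ 1 / (n : ℝ) ^ 2 * (n + 1) := by gcongr
          _ ≤ 1 := by
            rw [one_div_mul_eq_div, div_le_one (by positivity)]
            nlinarith
      nlinarith
    have hε0 : 0 ≤ (1 - β) ^ N * β / (1 - (1 - β) ^ N) := by
      have h1 : (1 - β) ^ N ≤ 1 := pow_le_one₀ (by linarith) (by linarith)
      have h2 : 0 ≤ (1 - β) ^ N := pow_nonneg (by linarith) _
      exact div_nonneg (mul_nonneg h2 hβ0.le) (by linarith)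
    set ε := (1 - β) ^ N * β / (1 - (1 - β) ^ N)
    -- Because `w ≥ 1` and `N ≥ r`, an edge spans at least one step, and rounding up at most doubles
    -- the number of steps.
    have hs : (⌈w s(x, y) / (r / N)⌉₊ : ℝ) ≤ 2 * (w s(x, y) * N / r) := by
      have h1 : 1 ≤ w s(x, y) * N / r := by
        rw [one_le_div hr0]
        nlinarith
      have h2 : w s(x, y) / (r / N) = w s(x, y) * N / r := by field_simp
      rw [h2]
      linarith [Nat.ceil_lt_add_one (zero_le_one.trans h1)]
    have hreal : D.toMeasure.real {P | P.center x ≠ P.center y} ≤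
        ⌈w s(x, y) / (r / N)⌉₊ * (β + n * ε) := by
      rw [measureReal_def]
      apply ENNReal.toReal_le_of_le_ofReal (by positivity)
      refine ((hDcut x y).trans (hcut x (Finset.mem_univ _) y (Finset.mem_univ _) hxy)).trans ?_
      rw [ENNReal.ofReal_mul (by positivity), ENNReal.ofReal_add (by positivity) (by positivity),
        ENNReal.ofReal_mul (by positivity), ENNReal.ofReal_natCast, ENNReal.ofReal_natCast,
        Finset.card_univ, Fintype.card_fin]
    calc _ ≤ 2 * (w s(x, y) * N / r) * (β + β) := hreal.trans (by gcongr)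
      _ = _ := by
        rw [hβ]
        field_simp
        ring

/-- Increasing the quality parameter preserves low-diameter decompositions. -/
theorem IsLDD.mono_quality (hw : ∀ e ∈ G.edgeSet, 0 ≤ w e) {r a a' δ : ℝ} (hr : 0 ≤ r)
    (ha : a ≤ a') {D : PMF (Clustering G)} (h : IsLDD G w r a δ D) : IsLDD G w r a' δ D :=
  ⟨h.1, fun x y => (h.2 x y).trans
    (mul_le_mul_of_nonneg_right ha (div_nonneg (wdist_nonneg hw x y) hr))⟩

end LowDiameter

end ObliviousRouting

theorem mainTheorem4 :
    (∃ c₀ : ℝ, 0 < c₀ ∧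
      ∀ n : ℕ, 3 ≤ n → ∀ (G : SimpleGraph (Fin n)) (w : Sym2 (Fin n) → ℝ),
        G.Connected → (∀ e ∈ G.edgeSet, 1 ≤ w e) → ∀ r : ℝ, 1 ≤ r →
          ∃ D : PMF (ObliviousRouting.Clustering G),
            ObliviousRouting.IsLDD G w r (ObliviousRouting.quality c₀ n) 0 D) ∧
    ∀ C cα cρ ci : ℝ, 0 ≤ C → 0 < cα → 0 < cρ → 0 < ci →
      ∃ A : ℝ, 0 < A ∧
        ∀ C' : ℝ, 0 < C' →
          ∃ cg₀ : ℝ, 0 < cg₀ ∧ ∀ cg : ℝ, cg₀ ≤ cg →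
            ∃ K₀ : ℝ, 0 < K₀ ∧ ∀ K : ℝ, K₀ ≤ K →
              ∀ n : ℕ, 3 ≤ n →
              ∀ (α ρ : ℝ) (m g : ℕ),
                α = ObliviousRouting.quality cα n →
                ρ = ObliviousRouting.expThreeQuarters cρ n →
                m = ObliviousRouting.numLevels ci n →
                g = ObliviousRouting.numSamples cg n ρ α →
                (n : ℝ) ^ (C + 1) ≤ ρ ^ m →
              ∀ (G : SimpleGraph (Fin n)) (w : Sym2 (Fin n) → ℝ),
                G.Connected →
                (∀ e ∈ G.edgeSet, 1 ≤ w e ∧ w e ≤ (n : ℝ) ^ C) →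
              ∀ D : Fin m → PMF (ObliviousRouting.Clustering G),
                (∀ i : Fin m,
                  ObliviousRouting.IsLDD G w (ρ ^ ((i : ℕ) + 1)) α ((n : ℝ) ^ (-K)) (D i)) →
                1 - (n : ℝ) ^ (-C') ≤
                  (ObliviousRouting.sampleLaw (g := g) D).real
                    {ω | ObliviousRouting.Succeeds G w ρ
                      (ObliviousRouting.expThreeQuarters A n) ω} := by
  refine ⟨?_, fun C cα cρ ci _ => ObliviousRouting.exists_constants_succeeds C cα cρ ci⟩
  obtain ⟨c₀, hc₀, hle⟩ := ObliviousRouting.exists_log_le_quality 8 (by norm_num)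
  refine ⟨c₀, hc₀, fun n hn G w hG hw r hr => ?_⟩
  obtain ⟨D, hD⟩ := ObliviousRouting.exists_isLDD_log hn hG hw hr
  exact ⟨D, hD.mono_quality (fun e he => zero_le_one.trans (hw e he)) (by linarith) (hle n hn)⟩
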